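/- **Setting.** A function $W:\mathbb R^d\to\mathbb R$ is *polyhedral convex* if it is the maximum of finitely many affine functions, and *positively one-homogeneous* if $W(tp)=tW(p)$ for $t\ge 0$. Its subdifferential is $\partial W(p)=\{\xi : W(p)+\xi\cdot(q-p)\le W(q)\ \forall q\}$, and $\dim\partial W(p)$ is the dimension of the affine hull of $\partial W(p)$. For $\psi$ Lipschitz on an open set $\Omega\subset\mathbb R^d$, let $CH_W(\psi;\Omega)$ be the set of *Cahn–Hoffman vector fields*: all $z\in L^\infty(\Omega;\mathbb R^d)$ with distributional divergence $\operatorname{div}z\in L^2(\Omega)$ and $z(x)\in\partial W(\nabla\psi(x))$ for a.e. $x\in\Omega$. Let $\mathcal P^k$ be the set of ordered pairs $(A_-,A_+)$ of disjoint subsets of $\mathbb R^k$, ordered by $(A_-,A_+)\preceq(B_-,B_+)$ if and only if $A_+\subset B_+$ and $B_-\subset A_-$. The pair is *open* if $A_-$ and $A_+$ are open, *bounded* if $A_-^c$ or $A_+^c$ is bounded, and its *facet* is $A_-^c\cap A_+^c$. A *support function* of an open pair is a Lipschitz function $\psi:\mathbb R^k\to\mathbb R$ with $\psi>0$ on $A_+$,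 $\psi=0$ on the facet and $\psi<0$ on $A_-$. For $E\subset\mathbb R^k$ put $\mathcal U^\rho(E)=E+\overline{B_\rho(0)}$ if $\rho>0$, $\mathcal U^0(E)=E$, and $\mathcal U^\rho(E)=\{x\in E:\overline{B_{|\rho|}(x)}\subset E\}$ if $\rho<0$; put $\mathcal U^\rho(A_-,A_+)=(\mathcal U^{-\rho}(A_-),\mathcal U^{\rho}(A_+))$. For $W:\mathbb R^k\to\mathbb R$ convex, a support function $\psi$ of a bounded open pair is *admissible* for $W$ if $CH_W(\psi;G)\neq\emptyset$ for some open set $G$ containing the facet of the pair. For $W:\mathbb R^n\to\mathbb R$ polyhedral convex, $p_0\in\mathbb R^n$ and $k=\dim\partial W(p_0)$, let $V$ be the linear subspace parallel to the affine hull of $\partial W(p_0)$, let $\mathcal T_V:\mathbb R^k\to V$ be a linear isometry onto $V$, let $W'_{p_0}(q)=\lim_{t\to0+}(W(p_0+tq)-W(p_0))/t$, and let $W^{\rm sl}_{p_0}=W'_{p_0}\circ\mathcal T_V:\mathbb R^k\to\mathbb R$ be the *sliced density*. A support function of a bounded open pair in $\mathcal P^k$ is *$p_0$-admissible* if it is admissible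 for $W^{\rm sl}_{p_0}$. **Theorem.** Let $k\in\{1,2\}$, let $(A_-,A_+)\in\mathcal P^k$ be a bounded pair, and let $0\le\rho_1<\rho_2$. 1. Let $W:\mathbb R^k\to\mathbb R$ be a convex, positively one-homogeneous, polyhedral function for which there is $\delta>0$ with $W(p)\ge\delta|p|$ for all $p$. Then there is a bounded open pair $(G_-,G_+)\in\mathcal P^k$ with $$\mathcal U^{\rho_1}(A_-,A_+)\preceq(G_-,G_+)\preceq\mathcal U^{\rho_2}(A_-,A_+)$$ that has an admissible support function $\psi$ for which $CH_W(\psi;\mathbb R^k)$ contains a Lipschitz vector field. 2. Let $n\ge 0$, let $W:\mathbb R^n\to\mathbb R$ be polyhedral convex, and let $p_0\in\mathbb R^n$ with $\dim\partial W(p_0)=k$. Then, for every choice of the isometry $\mathcal T_V$, there is a bounded open pair $(G_-,G_+)\in\mathcal P^k$ satisfying the same two relations that has a $p_0$-admissible support function $\psi$ for which $CH_{W^{\rm sl}_{p_0}}(\psi;\mathbb R^k)$ contains a Lipschitz vector field. -/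

import Mathlib

open Set MeasureTheory

open scoped ContDiff Pointwise Topology ENNReal

noncomputable section

/-- Euclidean space `ℝᵏ`. -/
abbrev RR (k : ℕ) : Type := EuclideanSpace ℝ (Fin k)

/-! Convex functions -/

/-- The subdifferential `∂W(p)` of a finite convex function `W` on `ℝᵈ`. -/
def subdiff {d : ℕ} (W : RR d → ℝ) (p : RR d) : Set (RR d) :=
  {ξ | ∀ q, W p + inner ℝ ξ (q - p) ≤ W q}

/-- `W(tp) = tW(p)` for `t ≥ 0`. -/
def PosHomogeneous {d : ℕ} (W : RR d → ℝ) : Prop :=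
  ∀ t : ℝ, 0 ≤ t → ∀ p, W (t • p) = t * W p

/-- A (finite) polyhedral convex function: the maximum of finitely many affine functions. -/
def PolyhedralFun {d : ℕ} (W : RR d → ℝ) : Prop :=
  ∃ (s : Finset (RR d × ℝ)) (hs : s.Nonempty),
    ∀ p, W p = s.sup' hs fun a => inner ℝ a.1 p + a.2

/-- The linear subspace `V` parallel to the affine hull of `∂W(p)`. Its dimension is the
dimension of the (nonempty) convex set `∂W(p)`. -/
def featureSpace {n : ℕ} (W : RR n → ℝ) (p : RR n) : Submodule ℝ (RR n) :=
  (affineSpan ℝ (subdiff W p)).direction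

/-- The one-sided directional derivative
`W'_p(q) = lim_{t → 0+} (W(p + t q) - W(p)) / t`, as a right derivative at `t = 0`.
It exists whenever `W` is convex. -/
def dirDeriv {n : ℕ} (W : RR n → ℝ) (p q : RR n) : ℝ :=
  derivWithin (fun t : ℝ => W (p + t • q)) (Ioi 0) 0

/-- The sliced density `W^sl_p = W'_p ∘ T_V` on `ℝᵏ`, where `T_V` is a linear isometry of `ℝᵏ`
onto the subspace `V` parallel to the affine hull of `∂W(p)`. -/
def slicedDensity {n k : ℕ} (W : RR n → ℝ) (p : RR n) (T : RR k ≃ₗᵢ[ℝ] featureSpace W p) :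
    RR k → ℝ :=
  fun x => dirDeriv W p (T x : RR n)

/-! Cahn-Hoffman vector fields -/

/-- `g` is the distributional divergence of `z` on the open set `Ω`. -/
def HasWeakDivOn {d : ℕ} (z : RR d → RR d) (g : RR d → ℝ) (Ω : Set (RR d)) : Prop :=
  ∀ φ : RR d → ℝ, ContDiff ℝ ∞ φ → HasCompactSupport φ → tsupport φ ⊆ Ω →
    ∫ x in Ω, inner ℝ (z x) (gradient φ x) = - ∫ x in Ω, g x * φ x

/-- `CH_W(ψ; Ω)`, for a function `ψ` that is Lipschitz on the open set `Ω`: the bounded vector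
fields on `Ω` with distributional divergence in `L²(Ω)` and with `z(x) ∈ ∂W(∇ψ(x))` for almost
every `x ∈ Ω`. (A Lipschitz `ψ` is differentiable almost everywhere.) -/
def cahnHoffman {d : ℕ} (W : RR d → ℝ) (ψ : RR d → ℝ) (Ω : Set (RR d)) : Set (RR d → RR d) :=
  {z | MemLp z ∞ (volume.restrict Ω) ∧
    (∃ g : RR d → ℝ, MemLp g 2 (volume.restrict Ω) ∧ HasWeakDivOn z g Ω) ∧
    ∀ᵐ x ∂(volume.restrict Ω), z x ∈ subdiff W (gradient ψ x)}

/-! Generalized neighborhoods and pairs -/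

/-- The generalized neighborhood `U^ρ(E)`. -/
def gnbd {k : ℕ} (ρ : ℝ) (E : Set (RR k)) : Set (RR k) :=
  if 0 < ρ then E + Metric.closedBall 0 ρ
  else if ρ = 0 then E
  else {x | x ∈ E ∧ Metric.closedBall x |ρ| ⊆ E}

theorem disjoint_gnbd_aux {k : ℕ} {ρ : ℝ} (hρ : 0 < ρ) {A B : Set (RR k)} (h : Disjoint A B) :
    Disjoint (gnbd (-ρ) A) (gnbd ρ B) := by
  have h1 : ¬ (0 < -ρ) := by linarith
  have h2 : ¬ (-ρ = 0) := by intro h; linarith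
  rw [Set.disjoint_left] at h ⊢
  intro x hx hx'
  simp only [gnbd, if_neg h1, if_neg h2, if_pos hρ, abs_neg, abs_of_pos hρ] at hx hx'
  obtain ⟨b, hb, c, hc, rfl⟩ := Set.mem_add.1 hx'
  refine h (hx.2 ?_) hb
  simpa [Metric.mem_closedBall, dist_eq_norm] using hc

theorem disjoint_gnbd {k : ℕ} (ρ : ℝ) {A B : Set (RR k)} (h : Disjoint A B) :
    Disjoint (gnbd (-ρ) A) (gnbd ρ B) := by
  rcases lt_trichotomy ρ 0 with hρ | hρ | hρ
  · have := (disjoint_gnbd_aux (ρ := -ρ) (by linarith) h.symm).symm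
    rwa [neg_neg] at this
  · subst hρ
    simpa [gnbd] using h
  · exact disjoint_gnbd_aux hρ h

/-- The set `𝒫ᵏ` of ordered pairs `(A₋, A₊)` of disjoint subsets of `ℝᵏ`. -/
@[ext]
structure SetPair (k : ℕ) where
  minus : Set (RR k)
  plus : Set (RR k)
  disj : Disjoint minus plus

namespace SetPair

variable {k : ℕ}

/-- `(A₋, A₊) ≼ (B₋, B₊)` if and only if `A₊ ⊆ B₊` and `B₋ ⊆ A₋`. -/
instance : PartialOrder (SetPair k) where
  le A B := A.plus ⊆ B.plus ∧ B.minus ⊆ A.minus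
  le_refl _ := ⟨subset_rfl, subset_rfl⟩
  le_trans _ _ _ h h' := ⟨h.1.trans h'.1, h'.2.trans h.2⟩
  le_antisymm _ _ h h' := SetPair.ext (h'.2.antisymm h.2) (h.1.antisymm h'.1)

/-- `U^ρ(A₋, A₊) = (U^{-ρ}(A₋), U^ρ(A₊))`. -/
def nbd (ρ : ℝ) (A : SetPair k) : SetPair k where
  minus := gnbd (-ρ) A.minus
  plus := gnbd ρ A.plus
  disj := disjoint_gnbd ρ A.disj

/-- The pair is open. -/
def IsOpenPair (A : SetPair k) : Prop :=
  IsOpen A.minus ∧ IsOpen A.plus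

/-- The pair is bounded. -/
def IsBoundedPair (A : SetPair k) : Prop :=
  Bornology.IsBounded A.minusᶜ ∨ Bornology.IsBounded A.plusᶜ

/-- The facet of the pair. -/
def facet (A : SetPair k) : Set (RR k) :=
  A.minusᶜ ∩ A.plusᶜ

/-- `ψ` is a support function of the (open) pair. -/
def IsSupportFun (A : SetPair k) (ψ : RR k → ℝ) : Prop :=
  (∃ K, LipschitzWith K ψ) ∧ (∀ x ∈ A.plus, 0 < ψ x) ∧ (∀ x ∈ A.facet, ψ x = 0) ∧
    ∀ x ∈ A.minus, ψ x < 0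

/-- `ψ` is an admissible support function of the bounded open pair `A` with respect to the
energy density `W` on `ℝᵏ`: some open set containing the facet carries a Cahn-Hoffman vector
field. -/
def IsAdmissibleSupportFun (W : RR k → ℝ) (A : SetPair k) (ψ : RR k → ℝ) : Prop :=
  A.IsOpenPair ∧ A.IsBoundedPair ∧ A.IsSupportFun ψ ∧
    ∃ G : Set (RR k), IsOpen G ∧ A.facet ⊆ G ∧ (cahnHoffman W ψ G).Nonempty

/-- `ψ` is a `p`-admissible support function of the bounded open pair `A`: it is admissible
with respect to the sliced density `W^sl_p`. -/
def IsSlicedAdmissibleSupportFun {n : ℕ} (W : RR n → ℝ) (p : RR n)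
    (T : RR k ≃ₗᵢ[ℝ] featureSpace W p) (A : SetPair k) (ψ : RR k → ℝ) : Prop :=
  IsAdmissibleSupportFun (slicedDensity W p T) A ψ

end SetPair

end

open scoped NNReal

/-! ### Projections and coordinatewise maps -/

/-! In both parts the density is W(p) = max over a ∈ F of a·p, with F finite. Hence z ∈ ∂W(p) as
soon as z ∈ conv F and p lies in the normal cone of conv F at z. After subtracting some a₀ ∈ F, one
needs Lipschitz ψ and z, with z valued in P = conv F - a₀ and ∇ψ almost everywhere in the normal
cone of P at z ("calibration"). The constant a₀ does not affect the divergence, and a compactly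
supported Lipschitz field has square integrable divergence. Normal cones ignore dilations of the
variable and of P together with z, so P may be taken small compared with the mesh of a lattice.

Two one-sided calibrations suffice: one for P with ψ₁ > 0 on U^{ρ₁}(A₊), one for -P with ψ₂ > 0 on
U^{-ρ₂}(A₋), each vanishing farther than ε from its set. They live a positive distance apart, so ψ₁
- ψ₂ and z₁ - z₂ are calibrated and G = ({ψ₂ > 0}, {ψ₁ > 0}) works
(`LatticeCalibration.exists_admissible`).

A one-sided calibration is assembled on unit cells whose vertices are marked by nearness to the set.
ψ is 0 or 1/4 at a vertex according to its mark; along an edge with different marks it is a ramp,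
and z is a cut-off times a point of P extremal in the direction of the edge. Edge data depend only
on the marks of the edge, so neighbouring cells agree and `lipschitzWith_glue` applies; finitely
many markings give a uniform constant. In the plane, marks are made constant on a brick pattern of
horizontal dominoes, which rules out checkerboard cells: a cell is constant, has a horizontal
interface, or has one vertex differing from the other three.

The last case is the core (`exists_corner`). There ψ is a ramp of the distance to a translate of P
plus the negative quadrant. The normal at a nearest point is normal to P at a corresponding point of
P, and that point serves as z. -/

/-- The metric projection onto a nonempty closed convex set. -/
theorem exists_lipschitz_projection {E : Type*} [NormedAddCommGroup E] [InnerProductSpace ℝ E]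
    [CompleteSpace E] {K : Set E} (hne : K.Nonempty) (hc : IsClosed K) (hK : Convex ℝ K) :
    ∃ π : E → E, LipschitzWith 1 π ∧ (∀ x, π x ∈ K) ∧
      ∀ x, ∀ w ∈ K, inner ℝ (x - π x) (w - π x) ≤ 0 := by
  choose π hπK hπ using exists_norm_eq_iInf_of_complete_convex hne hc.isComplete hK
  have hvar : ∀ x, ∀ w ∈ K, inner ℝ (x - π x) (w - π x) ≤ 0 := fun x =>
    (norm_eq_iInf_iff_real_inner_le_zero hK (hπK x)).1 (hπ x)
  refine ⟨π, LipschitzWith.of_dist_le_mul fun x y => ?_, hπK, hvar⟩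
  rw [dist_eq_norm, dist_eq_norm, NNReal.coe_one, one_mul]
  have h1 := hvar x _ (hπK y)
  have h2 := hvar y _ (hπK x)
  have h3 : ‖π x - π y‖ ^ 2 ≤ inner ℝ (x - y) (π x - π y) := by
    rw [← real_inner_self_eq_norm_sq]
    simp only [inner_sub_left, inner_sub_right] at h1 h2 ⊢
    linarith
  have h4 := real_inner_le_norm (x - y) (π x - π y)
  by_contra hlt
  push Not at hlt
  have : 0 < ‖π x - π y‖ := (norm_nonneg _).trans_lt hlt
  nlinarith

theorem lipschitzWith_coordinatewise {k : ℕ} {φ : Fin k → ℝ → ℝ}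
    (hφ : ∀ i, LipschitzWith 1 (φ i)) :
    LipschitzWith 1 fun x : RR k => (WithLp.toLp 2 fun i => φ i (x i) : RR k) := by
  refine LipschitzWith.of_dist_le_mul fun x y => ?_
  rw [NNReal.coe_one, one_mul, EuclideanSpace.dist_eq, EuclideanSpace.dist_eq]
  refine Real.sqrt_le_sqrt (Finset.sum_le_sum fun i _ => ?_)
  have := (hφ i).dist_le_mul (x i) (y i)
  rw [NNReal.coe_one, one_mul] at this
  exact pow_le_pow_left₀ dist_nonneg this 2

theorem lipschitzWith_coord {k : ℕ} (i : Fin k) : LipschitzWith 1 fun x : RR k => x i :=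
  LipschitzWith.of_dist_le_mul fun x y => by
    simpa [dist_eq_norm] using PiLp.norm_apply_le (x - y) i

theorem lipschitzWith_smul_of_bounded {X E : Type*} [PseudoMetricSpace X] [NormedAddCommGroup E]
    [NormedSpace ℝ E] {f : X → ℝ} {g : X → E} {K L : ℝ≥0} {B C : ℝ≥0}
    (hf : LipschitzWith K f) (hg : LipschitzWith L g) (hfB : ∀ x, |f x| ≤ B)
    (hgC : ∀ x, ‖g x‖ ≤ C) : LipschitzWith (B * L + K * C) fun x => f x • g x := by
  refine LipschitzWith.of_dist_le_mul fun x y => ?_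
  have h : f x • g x - f y • g y = f x • (g x - g y) + (f x - f y) • g y := by
    rw [smul_sub, sub_smul]; abel
  rw [dist_eq_norm, h]
  refine (norm_add_le _ _).trans ?_
  rw [norm_smul, norm_smul, Real.norm_eq_abs]
  have h1 := hg.dist_le_mul x y
  have h2 := hf.dist_le_mul x y
  rw [dist_eq_norm] at h1 h2
  push_cast
  rw [add_mul, mul_assoc]
  have h3 := mul_le_mul (hfB x) h1 (norm_nonneg _) B.2
  have h4 := mul_le_mul h2 (hgC y) (norm_nonneg _) (by positivity)
  nlinarith

/-! ### Calibration: the inclusion `z ∈ ∂W(∇ψ)` in terms of the normal cone of `∂W(0)` -/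

/-- Whenever `ψ` has a gradient at `x`, this gradient lies in the normal cone of `P` at `ζ`. -/
def CalibratesAt {k : ℕ} (P : Set (RR k)) (ψ : RR k → ℝ) (ζ x : RR k) : Prop :=
  ∀ p, HasGradientAt ψ p x → ∀ ξ ∈ P, (inner ℝ ξ p : ℝ) ≤ inner ℝ ζ p

theorem CalibratesAt.congr {k : ℕ} {P : Set (RR k)} {ψ ψ' : RR k → ℝ} {ζ x : RR k}
    (h : CalibratesAt P ψ ζ x) (he : ψ' =ᶠ[𝓝 x] ψ) : CalibratesAt P ψ' ζ x :=
  fun p hp => h p (hp.congr_of_eventuallyEq he.symm)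

/-- The zero vector lies in every normal cone, so ζ is arbitrary wherever ψ is extremal. -/
theorem calibratesAt_of_isLocalMin {k : ℕ} {P : Set (RR k)} {ψ : RR k → ℝ} {ζ x : RR k}
    (h : IsLocalMin ψ x) : CalibratesAt P ψ ζ x := by
  intro p hp ξ _
  have h0 := h.hasFDerivAt_eq_zero hp.hasFDerivAt
  have : p = 0 := by simpa using h0
  simp [this]

theorem calibratesAt_of_isLocalMax {k : ℕ} {P : Set (RR k)} {ψ : RR k → ℝ} {ζ x : RR k}
    (h : IsLocalMax ψ x) : CalibratesAt P ψ ζ x := by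
  intro p hp ξ _
  have h0 := h.hasFDerivAt_eq_zero hp.hasFDerivAt
  have : p = 0 := by simpa using h0
  simp [this]

theorem CalibratesAt.comp_isometry {k : ℕ} {P : Set (RR k)} {ψ : RR k → ℝ} {ζ x : RR k}
    (R : RR k ≃ₗᵢ[ℝ] RR k) (h : CalibratesAt (R '' P) ψ (R ζ) (R x)) :
    CalibratesAt P (fun y => ψ (R y)) ζ x := by
  intro p hp ξ hξ
  have h1 : HasGradientAt ψ (R p) (R x) := by
    rw [hasGradientAt_iff_hasFDerivAt] at hp ⊢
    have h2 : HasFDerivAt (fun y => ψ (R y)) (InnerProductSpace.toDual ℝ (RR k) p)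
        (R.symm (R x)) := by simpa using hp
    have h3 := h2.comp (R x) R.symm.toContinuousLinearEquiv.hasFDerivAt
    have h4 : (fun y => ψ (R y)) ∘ R.symm = ψ := by
      ext y; simp
    rw [h4] at h3
    have h5 : InnerProductSpace.toDual ℝ (RR k) (R p) =
        (InnerProductSpace.toDual ℝ (RR k) p).comp (R.symm : RR k →L[ℝ] RR k) := by
      ext y
      have := R.inner_map_map p (R.symm y)
      simpa using this
    rw [h5]
    exact h3
  simpa using h (R p) h1 (R ξ) (mem_image_of_mem _ hξ)

theorem CalibratesAt.neg_left {k : ℕ} {P : Set (RR k)} {ψ : RR k → ℝ} {ζ x : RR k} {c : ℝ}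
    (h : CalibratesAt (-P) ψ ζ x) : CalibratesAt P (fun y => c - ψ y) (-ζ) x := by
  intro p hp ξ hξ
  have h1 : HasGradientAt ψ (-p) x := by
    rw [hasGradientAt_iff_hasFDerivAt] at hp ⊢
    have := hp.const_sub c
    simpa using this
  have := h _ h1 (-ξ) (by simpa using hξ)
  simpa using this

theorem CalibratesAt.neg {k : ℕ} {P : Set (RR k)} {ψ : RR k → ℝ} {ζ x : RR k}
    (h : CalibratesAt (-P) ψ ζ x) : CalibratesAt P (fun y => -ψ y) (-ζ) x := by
  simpa using h.neg_left (c := 0)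

theorem hasGradientAt_comp_add_const {k : ℕ} {ψ : RR k → ℝ} {p x a : RR k}
    (h : HasGradientAt (fun y => ψ (y + a)) p x) : HasGradientAt ψ p (x + a) := by
  rw [hasGradientAt_iff_hasFDerivAt] at h ⊢
  exact (hasFDerivAt_comp_add_right a).1 h

theorem CalibratesAt.comp_add_const {k : ℕ} {P : Set (RR k)} {ψ : RR k → ℝ} {ζ x a : RR k}
    (h : CalibratesAt P ψ ζ (x + a)) : CalibratesAt P (fun y => ψ (y + a)) ζ x :=
  fun p hp => h p (hasGradientAt_comp_add_const hp)

/-! ### Profiles -/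

/-- The profile of the support function across an interface. -/
noncomputable def ramp (t : ℝ) : ℝ := max 0 (min (t + 1 / 8) (1 / 4))

/-- The cut-off of the vector field across an interface. -/
noncomputable def hat (t : ℝ) : ℝ := max 0 (min 1 (2 - 8 * |t|))

theorem ramp_nonneg (t : ℝ) : 0 ≤ ramp t := le_max_left _ _

theorem ramp_le (t : ℝ) : ramp t ≤ 1 / 4 :=
  max_le (by norm_num) (min_le_right _ _)

theorem ramp_mono : Monotone ramp := fun s t h => by unfold ramp; gcongr

theorem ramp_of_le {t : ℝ} (h : t ≤ -1 / 8) : ramp t = 0 :=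
  max_eq_left ((min_le_left _ _).trans (by linarith))

theorem ramp_of_ge {t : ℝ} (h : 1 / 8 ≤ t) : ramp t = 1 / 4 := by
  rw [ramp, min_eq_right (by linarith), max_eq_right (by norm_num)]

theorem ramp_of_mem {t : ℝ} (h : -1 / 8 ≤ t) (h' : t ≤ 1 / 8) : ramp t = t + 1 / 8 := by
  rw [ramp, min_eq_left (by linarith), max_eq_right (by linarith)]

theorem ramp_neg (t : ℝ) : ramp (-t) = 1 / 4 - ramp t := by
  rcases le_total t (-1 / 8) with h | h
  · rw [ramp_of_le h, ramp_of_ge (by linarith)]; norm_num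
  rcases le_total t (1 / 8) with h' | h'
  · rw [ramp_of_mem h h', ramp_of_mem (by linarith) (by linarith)]; ring
  · rw [ramp_of_ge h', ramp_of_le (by linarith)]; norm_num

theorem lipschitzWith_ramp : LipschitzWith 1 ramp := by
  have h : LipschitzWith 1 fun t : ℝ => t + 1 / 8 :=
    LipschitzWith.of_dist_le_mul fun x y => by simp
  exact (h.min_const _).const_max _

theorem hat_nonneg (t : ℝ) : 0 ≤ hat t := le_max_left _ _

theorem hat_le (t : ℝ) : hat t ≤ 1 := max_le zero_le_one (min_le_left _ _)

theorem hat_neg (t : ℝ) : hat (-t) = hat t := by simp [hat]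

theorem hat_of_le {t : ℝ} (h : |t| ≤ 1 / 8) : hat t = 1 := by
  rw [hat, min_eq_left (by linarith), max_eq_right zero_le_one]

theorem hat_of_ge {t : ℝ} (h : 1 / 4 ≤ |t|) : hat t = 0 :=
  max_eq_left ((min_le_right _ _).trans (by linarith))

theorem lipschitzWith_hat : LipschitzWith 8 hat := by
  have h : LipschitzWith 8 fun t : ℝ => 2 - 8 * |t| :=
    LipschitzWith.of_dist_le_mul fun x y => by
      rw [Real.dist_eq, Real.dist_eq]
      have h1 : 2 - 8 * |x| - (2 - 8 * |y|) = -8 * (|x| - |y|) := by ring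
      rw [h1, abs_mul]
      have := abs_abs_sub_abs_le x y
      norm_num
      linarith
  exact (h.const_min _).const_max _

theorem abs_hat_le (t : ℝ) : |hat t| ≤ (1 : ℝ≥0) := by
  rw [abs_of_nonneg (hat_nonneg t)]; exact hat_le t

/-- A function with a subgradient `n` at `x`, composed with `ramp`. -/
theorem calibratesAt_ramp_comp {k : ℕ} {P : Set (RR k)} {g : RR k → ℝ} {ζ x n : RR k}
    (hn : |g x| < 1 / 8 → ∀ y, g x + inner ℝ n (y - x) ≤ g y)
    (h : |g x| < 1 / 8 → ∀ ξ ∈ P, (inner ℝ ξ n : ℝ) ≤ inner ℝ ζ n) :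
    CalibratesAt P (fun y => ramp (g y)) ζ x := by
  by_cases hg : |g x| < 1 / 8
  · intro p hp ξ hξ
    have hg' := abs_lt.1 hg
    -- `ramp` is increasing and is a translation near `g x`, so the subgradient inequality survives
    -- locally. Any gradient of the composition must then equal `n`; differentiability of `g` is not
    -- needed.
    have hmin : IsLocalMin (fun y => ramp (g y) - inner ℝ n y) x := by
      have hc : Continuous fun y : RR k => g x + inner ℝ n (y - x) := by fun_prop
      have h1 : ∀ᶠ y in 𝓝 x, g x + inner ℝ n (y - x) < 1 / 8 :=
        hc.continuousAt.eventually_lt continuousAt_const (by simpa using hg'.2)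
      have h2 : ∀ᶠ y in 𝓝 x, -1 / 8 < g x + inner ℝ n (y - x) :=
        continuousAt_const.eventually_lt hc.continuousAt (by simp; linarith)
      filter_upwards [h1, h2] with y hy1 hy2
      have h3 := ramp_mono (hn hg y)
      rw [ramp_of_mem hy2.le hy1.le, inner_sub_right] at h3
      rw [ramp_of_mem (t := g x) (by linarith) (by linarith)]
      linarith
    have hd : HasFDerivAt (fun y : RR k => ramp (g y) - inner ℝ n y)
        (InnerProductSpace.toDual ℝ (RR k) p - innerSL ℝ n) x :=
      hp.hasFDerivAt.sub (innerSL ℝ n).hasFDerivAt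
    have h0 := hmin.hasFDerivAt_eq_zero hd
    have hpn : p = n := by
      rw [← sub_eq_zero, ← norm_eq_zero]
      have := congrArg (fun L : RR k →L[ℝ] ℝ => L (p - n)) h0
      simp only [_root_.sub_apply, InnerProductSpace.toDual_apply_apply,
        innerSL_apply_apply, _root_.zero_apply, ← inner_sub_left,
        real_inner_self_eq_norm_sq] at this
      simpa using this
    rw [hpn]
    exact h hg ξ hξ
  · rcases le_abs.1 (not_lt.1 hg) with h1 | h1
    · refine calibratesAt_of_isLocalMax (Filter.Eventually.of_forall fun y => ?_)
      simp only [ramp_of_ge h1]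
      exact ramp_le _
    · refine calibratesAt_of_isLocalMin (Filter.Eventually.of_forall fun y => ?_)
      simp only [ramp_of_le (show g x ≤ -1 / 8 by linarith)]
      exact ramp_nonneg _

/-! ### Rounded corners from the distance to the lower hull -/

/-- The sum of a planar set and the closed negative quadrant. -/
def lowerHull (P : Set (RR 2)) : Set (RR 2) := {y | ∃ ξ ∈ P, ∀ i, y i ≤ ξ i}

theorem convex_lowerHull {P : Set (RR 2)} (hP : Convex ℝ P) : Convex ℝ (lowerHull P) := by
  rintro x ⟨ξ, hξ, hx⟩ y ⟨ζ, hζ, hy⟩ a b ha hb hab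
  refine ⟨a • ξ + b • ζ, hP hξ hζ ha hb hab, fun i => ?_⟩
  have h1 := mul_le_mul_of_nonneg_left (hx i) ha
  have h2 := mul_le_mul_of_nonneg_left (hy i) hb
  simpa using add_le_add h1 h2

theorem isClosed_lowerHull {P : Set (RR 2)} (hP : IsCompact P) : IsClosed (lowerHull P) := by
  have h : lowerHull P = P + {y : RR 2 | ∀ i, y i ≤ 0} := by
    ext y
    constructor
    · rintro ⟨ξ, hξ, hy⟩
      exact ⟨ξ, hξ, y - ξ, fun i => by simpa using hy i, by simp⟩
    · rintro ⟨ξ, hξ, c, hc, rfl⟩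
      exact ⟨ξ, hξ, fun i => by simpa using hc i⟩
  rw [h]
  refine IsClosed.add_left_of_isCompact ?_ hP
  simp only [ofPred_forall]
  exact isClosed_iInter fun i => isClosed_le (by fun_prop) continuous_const

theorem inner_eq_two (x y : RR 2) : (inner ℝ x y : ℝ) = x 0 * y 0 + x 1 * y 1 := by
  simp [PiLp.inner_apply, Fin.sum_univ_two, mul_comm]

/-- If `g` is an outer normal of the lower hull of `P` at `y`, then raising the coordinates of `y`
to the levels of a topmost and a rightmost point of `P` leads into `P`. -/
theorem raise_mem_of_normal {P : Set (RR 2)} (hP : Convex ℝ P) {zr zt : RR 2} (hzr : zr ∈ P)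
    (hzt : zt ∈ P) (hr : ∀ ξ ∈ P, ξ 0 ≤ zr 0) (ht : ∀ ξ ∈ P, ξ 1 ≤ zt 1) {y g : RR 2}
    (hy : y ∈ lowerHull P) (hg : g ≠ 0) (hn : ∀ s ∈ lowerHull P, (inner ℝ g (s - y) : ℝ) ≤ 0) :
    (0 ≤ g 0 ∧ 0 ≤ g 1) ∧ !₂[max (y 0) (zt 0), max (y 1) (zr 1)] ∈ P := by
  obtain ⟨ξ, hξ, hyξ⟩ := hy
  have hy0 := hyξ 0
  have hy1 := hyξ 1
  have hsub : ∀ s ∈ P, s ∈ lowerHull P := fun s hs => ⟨s, hs, fun _ => le_rfl⟩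
  have hg0 : 0 ≤ g 0 := by
    have := hn (y - EuclideanSpace.single 0 1) ⟨ξ, hξ, fun i => by
      refine le_trans ?_ (hyξ i)
      fin_cases i <;> simp⟩
    simpa [inner_eq_two] using this
  have hg1 : 0 ≤ g 1 := by
    have := hn (y - EuclideanSpace.single 1 1) ⟨ξ, hξ, fun i => by
      refine le_trans ?_ (hyξ i)
      fin_cases i <;> simp⟩
    simpa [inner_eq_two] using this
  have hnξ := hn ξ (hsub ξ hξ)
  have hnr := hn zr (hsub zr hzr)
  have hnt := hn zt (hsub zt hzt)
  have hξr := hr ξ hξ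
  have hξt := ht ξ hξ
  have htr := hr zt hzt
  have hrt := ht zr hzr
  simp only [inner_eq_two, PiLp.sub_apply] at hnξ hnr hnt
  -- Both terms of ⟨g, ξ - y⟩ are nonnegative and their sum is at most 0, so both vanish.
  have e0 : g 0 * (ξ 0 - y 0) = 0 := by
    linarith [mul_nonneg hg0 (sub_nonneg.2 hy0), mul_nonneg hg1 (sub_nonneg.2 hy1)]
  have e1 : g 1 * (ξ 1 - y 1) = 0 := by linarith [mul_nonneg hg1 (sub_nonneg.2 hy1)]
  refine ⟨⟨hg0, hg1⟩, ?_⟩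
  -- a point of `P` agreeing with a convex combination of two points of `P`
  have key : ∀ {u v w : RR 2} {j : Fin 2}, u ∈ P → v ∈ P → (∀ i, i ≠ j → u i = w i) →
      (∀ i, i ≠ j → v i = w i) → u j ≤ w j → w j ≤ v j → w ∈ P := by
    intro u v w j hu hv hui hvi huj hvj
    have hw : w j ∈ segment ℝ (u j) (v j) := by
      rw [segment_eq_Icc (huj.trans hvj)]; exact ⟨huj, hvj⟩
    obtain ⟨a, b, ha, hb, hab, h⟩ := hw
    have : w = a • u + b • v := by
      ext i
      by_cases hij : i = j
      · subst hij; simpa using h.symm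
      · simp [hui i hij, hvi i hij, ← add_mul, hab]
    rw [this]
    exact hP hu hv ha hb hab
  -- A vertical normal puts `y` at the top height; raising it stays on the top face of `P`, between
  -- `zt` and `ξ`. A horizontal normal is symmetric. If both components are positive, `y = ξ` and
  -- nothing is raised.
  rcases hg0.eq_or_lt with h0 | h0
  · have h1 : 0 < g 1 := by
      refine hg1.lt_of_ne fun h1 => hg ?_
      ext i; fin_cases i
      · exact h0.symm
      · exact h1.symm
    have e2 : ξ 1 = y 1 := by
      rcases mul_eq_zero.1 e1 with h | h <;> linarith
    have e3 : y 1 = zt 1 := by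
      rw [← h0] at hnt
      have : g 1 * (zt 1 - y 1) ≤ 0 := by linarith
      nlinarith
    refine key (u := zt) (v := if y 0 ≤ zt 0 then zt else ξ) (j := 0) hzt
      (by split_ifs <;> assumption) ?_ ?_ (by simp) ?_
    · intro i hi
      fin_cases i
      · simp at hi
      · simp [e3, hrt]
    · intro i hi
      fin_cases i
      · simp at hi
      · split_ifs
        · simp [e3, hrt]
        · simp [e2, e3, hrt]
    · split_ifs with h
      · simp [h]
      · simp [hy0, (le_of_not_ge h).trans hy0]
  have e2 : ξ 0 = y 0 := by
    rcases mul_eq_zero.1 e0 with h | h <;> linarith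
  rcases hg1.eq_or_lt with h1 | h1
  · have e3 : y 0 = zr 0 := by
      rw [← h1] at hnr
      have : g 0 * (zr 0 - y 0) ≤ 0 := by linarith
      nlinarith
    refine key (u := zr) (v := if y 1 ≤ zr 1 then zr else ξ) (j := 1) hzr
      (by split_ifs <;> assumption) ?_ ?_ (by simp) ?_
    · intro i hi
      fin_cases i
      · simp [e3, htr]
      · simp at hi
    · intro i hi
      fin_cases i
      · split_ifs
        · simp [e3, htr]
        · simp [e2, e3, htr]
      · simp at hi
    · split_ifs with h
      · simp [h]
      · simp [hy1, (le_of_not_ge h).trans hy1]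
  · have e3 : ξ 1 = y 1 := by
      rcases mul_eq_zero.1 e1 with h | h <;> linarith
    have e4 : zt 0 ≤ y 0 := by nlinarith
    have e5 : zr 1 ≤ y 1 := by nlinarith
    convert hξ using 1
    ext i
    fin_cases i
    · simp [e4, e2]
    · simp [e5, e3]

/-- The support function and the vector field of a rounded corner, in a square cell centred at the
origin: the support function vanishes near the lower left vertex only. -/
theorem exists_corner {P : Set (RR 2)} (hc : IsCompact P) (hP : Convex ℝ P) (h0 : 0 ∈ P)
    (hsmall : ∀ ξ ∈ P, ∀ i, |ξ i| ≤ 1 / 8) {zr zt : RR 2} (hzr : zr ∈ P)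
    (hzt : zt ∈ P) (hr : ∀ ξ ∈ P, ξ 0 ≤ zr 0) (ht : ∀ ξ ∈ P, ξ 1 ≤ zt 1) :
    ∃ (ψ : RR 2 → ℝ) (z : RR 2 → RR 2), (∃ K, LipschitzWith K ψ) ∧ (∃ K, LipschitzWith K z) ∧
      (∀ x, 0 ≤ ψ x ∧ ψ x ≤ 1 / 4) ∧ (∀ x, z x ∈ P) ∧ (∀ x, CalibratesAt P ψ (z x) x) ∧
      (∀ x, x 1 ≤ -1 / 2 → ψ x = ramp (x 0) ∧ z x = hat (x 0) • zr) ∧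
      (∀ x, x 0 ≤ -1 / 2 → ψ x = ramp (x 1) ∧ z x = hat (x 1) • zt) ∧
      (∀ x, 1 / 2 ≤ x 0 ∨ 1 / 2 ≤ x 1 → ψ x = 1 / 4 ∧ z x = 0) := by
  have hne : P.Nonempty := ⟨0, h0⟩
  have hsub : ∀ s ∈ P, s ∈ lowerHull P := fun s hs => ⟨s, hs, fun _ => le_rfl⟩
  obtain ⟨π, hπL, hπS, hπ⟩ := exists_lipschitz_projection
    ⟨0, hsub 0 h0⟩ (isClosed_lowerHull hc) (convex_lowerHull hP)
  obtain ⟨ϖ, hϖL, hϖP, hϖ⟩ := exists_lipschitz_projection hne hc.isClosed hP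
  have hϖid : ∀ x ∈ P, ϖ x = x := fun x hx => by
    have := hϖ x x hx
    rw [real_inner_self_eq_norm_sq] at this
    have : ‖x - ϖ x‖ = 0 := by nlinarith [norm_nonneg (x - ϖ x)]
    exact (sub_eq_zero.1 (norm_eq_zero.1 this)).symm
  -- a point of the hull with vanishing variational inequality is the projection
  have huniq : ∀ y v, v ∈ lowerHull P → (∀ s ∈ lowerHull P, (inner ℝ (y - v) (s - v) : ℝ) ≤ 0) →
      π y = v := fun y v hv h => by
    have h1 := hπ y v hv
    have h2 := h (π y) (hπS y)
    have h3 : ‖π y - v‖ ^ 2 ≤ 0 := by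
      rw [← real_inner_self_eq_norm_sq]
      simp only [inner_sub_left, inner_sub_right] at h1 h2 ⊢
      rw [real_inner_comm v (π y)] at *
      linarith
    have : ‖π y - v‖ = 0 := by nlinarith [norm_nonneg (π y - v)]
    exact sub_eq_zero.1 (norm_eq_zero.1 this)
  -- This shift puts the right and top sides of the hull on the lines where a coordinate of x is
  -- -1/4, so that the level `D = 1/4` meets the edges of the cell at their midpoints.
  set q : RR 2 := !₂[1 / 4 + zr 0, 1 / 4 + zt 1] with hq
  have hq0 : q 0 = 1 / 4 + zr 0 := by simp [hq]
  have hq1 : q 1 = 1 / 4 + zt 1 := by simp [hq]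
  -- A nearest point may lie on one of the two rays the hull adds to `P`; `κ` slides it along the
  -- ray to its endpoint in `P`.
  set κ : RR 2 → RR 2 := fun y => !₂[max (y 0) (zt 0), max (y 1) (zr 1)] with hκ
  have hκL : LipschitzWith 1 κ := by
    have : κ = fun y : RR 2 => (WithLp.toLp 2 fun i => max (y i) (![zt 0, zr 1] i) : RR 2) := by
      ext y i; fin_cases i <;> simp [hκ]
    rw [this]
    exact lipschitzWith_coordinatewise (φ := fun i t => max t (![zt 0, zr 1] i))
      fun i => LipschitzWith.id.max_const _
  set D : RR 2 → ℝ := fun x => ‖(x + q) - π (x + q)‖ with hD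
  have hshift : LipschitzWith 1 fun x : RR 2 => x + q :=
    LipschitzWith.of_dist_le_mul fun x y => by simp
  have hDL : LipschitzWith ((1 + 1) * 1) D :=
    ((lipschitzWith_one_norm.comp (LipschitzWith.id.sub hπL)).weaken (by norm_num)).comp hshift
  have hgL : LipschitzWith ((1 + 1) * 1) fun x => D x - 1 / 4 :=
    LipschitzWith.of_dist_le_mul fun x y => by simpa using hDL.dist_le_mul x y
  -- `ϖ` acts as the identity wherever `D > 0`. Where `D = 0` the cut-off vanishes, and `ϖ` only
  -- keeps `Z` valued in `P` and Lipschitz.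
  set Z : RR 2 → RR 2 := fun x => ϖ (κ (π (x + q))) with hZ
  have hZL : LipschitzWith (1 * (1 * (1 * 1))) Z := hϖL.comp (hκL.comp (hπL.comp hshift))
  have hZP : ∀ x, Z x ∈ P := fun x => hϖP _
  obtain ⟨C, hC⟩ := hc.isBounded.exists_norm_le
  have hDnn : ∀ x, 0 ≤ D x := fun x => norm_nonneg _
  have hcoord : ∀ ξ ∈ P, ∀ i, -1 / 8 ≤ ξ i ∧ ξ i ≤ 1 / 8 := fun ξ hξ i => by
    have := abs_le.1 (hsmall ξ hξ i)
    constructor <;> linarith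
  have hDle : ∀ x i, x i + q i - (![zr 0, zt 1] : Fin 2 → ℝ) i ≤ D x := by
    intro x i
    have h1 : ‖(x + q - π (x + q)) i‖ ≤ D x := PiLp.norm_apply_le _ i
    obtain ⟨ξ, hξ, hle⟩ := hπS (x + q)
    have h2 : π (x + q) i ≤ (![zr 0, zt 1] : Fin 2 → ℝ) i := by
      refine (hle i).trans ?_
      fin_cases i
      · exact hr ξ hξ
      · exact ht ξ hξ
    have h3 := (le_abs_self _).trans h1
    simp only [PiLp.sub_apply, PiLp.add_apply] at h3
    linarith
  refine ⟨fun x => ramp (D x - 1 / 4), fun x => hat (D x - 1 / 4) • Z x,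
    ⟨_, lipschitzWith_ramp.comp hgL⟩,
    ⟨_, lipschitzWith_smul_of_bounded (C := C.toNNReal) (lipschitzWith_hat.comp hgL) hZL
      (fun x => abs_hat_le _) fun x => (hC _ (hZP x)).trans (Real.le_coe_toNNReal C)⟩,
    fun x => ⟨ramp_nonneg _, ramp_le _⟩,
    fun x => hP.smul_mem_of_zero_mem h0 (hZP x) ⟨hat_nonneg _, hat_le _⟩, ?_, ?_, ?_, ?_⟩
  · intro x
    have hcase : |D x - 1 / 4| < 1 / 8 → D x ≠ 0 := fun h h' => by
      rw [h', abs_lt] at h; linarith [h.1]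
    refine calibratesAt_ramp_comp (n := (D x)⁻¹ • (x + q - π (x + q))) (fun h y => ?_)
      fun h ξ hξ => ?_
    · have hpos : 0 < D x := (hDnn x).lt_of_ne' (hcase h)
      have h1 := hπ (x + q) _ (hπS (y + q))
      have h2 := real_inner_le_norm (x + q - π (x + q)) (y + q - π (y + q))
      change _ ≤ D x * D y at h2
      have h3 : (inner ℝ (x + q - π (x + q)) (x + q - π (x + q)) : ℝ) = D x ^ 2 :=
        real_inner_self_eq_norm_sq _
      -- The supporting inequality of the convex function `D` at `x`, multiplied by `D x`.
      have h4 : (inner ℝ (x + q - π (x + q)) (y - x) : ℝ) + D x ^ 2 ≤ D x * D y := by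
        have e : y - x = (y + q - π (y + q)) - (x + q - π (x + q)) + (π (y + q) - π (x + q)) := by
          abel
        rw [e, inner_add_right, inner_sub_right, h3]
        linarith
      rw [real_inner_smul_left]
      have h5 : (D x)⁻¹ * ((inner ℝ (x + q - π (x + q)) (y - x) : ℝ) + D x ^ 2) ≤
          (D x)⁻¹ * (D x * D y) := mul_le_mul_of_nonneg_left h4 (by positivity)
      rw [mul_add, inv_mul_cancel_left₀ hpos.ne', sq, inv_mul_cancel_left₀ hpos.ne'] at h5
      linarith
    · have hpos : 0 < D x := (hDnn x).lt_of_ne' (hcase h)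
      have hg : x + q - π (x + q) ≠ 0 := norm_ne_zero_iff.1 hpos.ne'
      obtain ⟨⟨hg0, hg1⟩, hmem⟩ := raise_mem_of_normal hP hzr hzt hr ht (hπS _) hg (hπ (x + q))
      have hZx : Z x = κ (π (x + q)) := hϖid _ hmem
      simp only [hat_of_le h.le, one_smul, hZx, real_inner_smul_right]
      refine mul_le_mul_of_nonneg_left ?_ (by positivity)
      have h1 := hπ (x + q) ξ (hsub ξ hξ)
      rw [inner_eq_two] at h1 ⊢
      rw [inner_eq_two]
      have h2 := mul_le_mul_of_nonneg_left (le_max_left (π (x + q) 0) (zt 0)) hg0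
      have h3 := mul_le_mul_of_nonneg_left (le_max_left (π (x + q) 1) (zr 1)) hg1
      simp only [hκ, PiLp.sub_apply, PiLp.toLp_apply, Matrix.cons_val_zero, Matrix.cons_val_one]
        at h1 h2 h3 ⊢
      linarith
  -- The bound 1/8 enters here: `zt 1 - zr 1 ≤ 1/4`, so `x + q` is no higher than `zr`. Either it is
  -- in the hull or it projects horizontally onto the vertical ray below `zr`. The next bullet is
  -- symmetric.
  · intro x hx
    have hr1 := hcoord zr hzr 1
    have ht1 := hcoord zt hzt 1
    rcases le_total (x 0) (-1 / 4) with h | h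
    · have hmem : x + q ∈ lowerHull P := ⟨zr, hzr, fun i => by
        fin_cases i
        · simp [hq0]; linarith
        · simp [hq1]; linarith⟩
      have hDx : D x = 0 := by
        have : π (x + q) = x + q := huniq _ _ hmem fun s _ => by simp
        simp [hD, this]
      have hh : (1 : ℝ) / 4 ≤ |x 0| := by rw [abs_of_nonpos] <;> linarith
      have hh' : (1 : ℝ) / 4 ≤ |0 - 1 / 4| := by norm_num
      simp only [hDx]
      rw [ramp_of_le (by norm_num), ramp_of_le (by linarith), hat_of_ge hh, hat_of_ge hh']
      simp
    · have hπx : π (x + q) = !₂[zr 0, x 1 + q 1] := by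
        refine huniq _ _ ⟨zr, hzr, fun i => ?_⟩ fun s hs => ?_
        · fin_cases i
          · simp
          · simp [hq1]; linarith
        · obtain ⟨ξ, hξ, hle⟩ := hs
          have h1 := (hle 0).trans (hr ξ hξ)
          simp only [inner_eq_two, PiLp.sub_apply, PiLp.add_apply,
            Matrix.cons_val_zero, Matrix.cons_val_one, sub_self, zero_mul, add_zero, hq0]
          nlinarith
      have hDx : D x = x 0 + 1 / 4 := by
        simp only [hD, hπx, EuclideanSpace.norm_eq, Fin.sum_univ_two]
        simp [hq0]
        rw [Real.sqrt_sq] <;> linarith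
      have hZx : Z x = zr := by
        have : κ (π (x + q)) = zr := by
          ext i
          fin_cases i
          · simp [hκ, hπx, hr zt hzt]
          · simp [hκ, hπx, hq1]; linarith
        simp only [hZ, this]
        exact hϖid _ hzr
      simp [hDx, hZx]
  · intro x hx
    have hr1 := hcoord zr hzr 0
    have ht1 := hcoord zt hzt 0
    rcases le_total (x 1) (-1 / 4) with h | h
    · have hmem : x + q ∈ lowerHull P := ⟨zt, hzt, fun i => by
        fin_cases i
        · simp [hq0]; linarith
        · simp [hq1]; linarith⟩
      have hDx : D x = 0 := by
        have : π (x + q) = x + q := huniq _ _ hmem fun s _ => by simp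
        simp [hD, this]
      have hh : (1 : ℝ) / 4 ≤ |x 1| := by rw [abs_of_nonpos] <;> linarith
      have hh' : (1 : ℝ) / 4 ≤ |0 - 1 / 4| := by norm_num
      simp only [hDx]
      rw [ramp_of_le (by norm_num), ramp_of_le (by linarith), hat_of_ge hh, hat_of_ge hh']
      simp
    · have hπx : π (x + q) = !₂[x 0 + q 0, zt 1] := by
        refine huniq _ _ ⟨zt, hzt, fun i => ?_⟩ fun s hs => ?_
        · fin_cases i
          · simp [hq0]; linarith
          · simp
        · obtain ⟨ξ, hξ, hle⟩ := hs
          have h1 := (hle 1).trans (ht ξ hξ)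
          simp only [inner_eq_two, PiLp.sub_apply, PiLp.add_apply,
            Matrix.cons_val_zero, Matrix.cons_val_one, sub_self, zero_mul, zero_add, hq1]
          nlinarith
      have hDx : D x = x 1 + 1 / 4 := by
        simp only [hD, hπx, EuclideanSpace.norm_eq, Fin.sum_univ_two]
        simp [hq1]
        rw [Real.sqrt_sq] <;> linarith
      have hZx : Z x = zt := by
        have : κ (π (x + q)) = zt := by
          ext i
          fin_cases i
          · simp [hκ, hπx, hq0]; linarith
          · simp [hκ, hπx, ht zr hzr]
        simp only [hZ, this]
        exact hϖid _ hzt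
      simp [hDx, hZx]
  · intro x hx
    have hDx : 3 / 4 ≤ D x := by
      rcases hx with h | h
      · have := hDle x 0
        simp [hq0] at this
        linarith
      · have := hDle x 1
        simp [hq1] at this
        linarith
    have : (1 : ℝ) / 4 ≤ |D x - 1 / 4| := by rw [abs_of_nonneg] <;> linarith
    simp only [hat_of_ge this, zero_smul, and_true]
    exact ramp_of_ge (by linarith)

/-! ### Gluing along the integer levels of a coordinate -/

/-- Cut the segment from x to y at the first level it crosses. Neighbouring pieces agree there and
lengths add along the segment, so the constant does not grow with the number of crossings. -/
theorem lipschitzWith_glue {k : ℕ} {Y : Type*} [PseudoMetricSpace Y] (i : Fin k) {K : ℝ≥0}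
    {f : ℤ → RR k → Y} (hf : ∀ m, LipschitzWith K (f m))
    (hc : ∀ (m : ℤ) (x : RR k), x i = m + 1 → f m x = f (m + 1) x) :
    LipschitzWith K fun x => f ⌊x i⌋ x := by
  have key : ∀ (n : ℕ) (x y : RR k), x i ≤ y i → ⌊y i⌋ = ⌊x i⌋ + n →
      dist (f ⌊x i⌋ x) (f ⌊y i⌋ y) ≤ K * dist x y := by
    intro n
    induction n with
    | zero =>
      intro x y _ h
      rw [h, Nat.cast_zero, add_zero]
      exact (hf _).dist_le_mul x y
    | succ n ih =>
      intro x y hxy h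
      set m := ⌊x i⌋ with hm
      have h1 : x i < m + 1 := Int.lt_floor_add_one _
      have h2 : (m : ℝ) + 1 ≤ y i := by
        have : m + 1 ≤ ⌊y i⌋ := by rw [h]; push_cast; omega
        exact_mod_cast Int.le_floor.1 this
      have hpos : 0 < y i - x i := by linarith
      set t := (m + 1 - x i) / (y i - x i) with ht
      have ht0 : 0 ≤ t := div_nonneg (by linarith) hpos.le
      have ht1 : t ≤ 1 := (div_le_one hpos).2 (by linarith)
      set w : RR k := x + t • (y - x) with hw
      have hwi : w i = m + 1 := by
        have : t * (y i - x i) = m + 1 - x i := div_mul_cancel₀ _ hpos.ne'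
        simp [hw, this]
      have hfl : ⌊w i⌋ = m + 1 := by
        rw [hwi]; simp
      have hseg : w ∈ segment ℝ x y := by
        rw [segment_eq_image']
        exact ⟨t, ⟨ht0, ht1⟩, rfl⟩
      have h3 := ih w y (by rw [hwi]; exact h2) (by rw [h, hfl]; push_cast; ring)
      rw [hfl, ← hc m w hwi] at h3
      have h4 := (hf m).dist_le_mul x w
      rw [← dist_add_dist_of_mem_segment hseg, mul_add]
      exact (dist_triangle _ _ _).trans (add_le_add h4 h3)
  refine LipschitzWith.of_dist_le_mul fun x y => ?_
  rcases le_total (x i) (y i) with h | h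
  · obtain ⟨n, hn⟩ := Int.le.dest (Int.floor_mono h)
    exact key n x y h hn.symm
  · obtain ⟨n, hn⟩ := Int.le.dest (Int.floor_mono h)
    rw [dist_comm, dist_comm x]
    exact key n y x h hn.symm

/-! ### Data on the edges of a cell -/

/-- The pair (support function, vector field) along an edge between vertices marked `a`, `b`. -/
noncomputable def edgeDatum {k : ℕ} (zp zm : RR k) : Bool → Bool → ℝ → ℝ × RR k
  | false, false, _ => (0, 0)
  | true, true, _ => (1 / 4, 0)
  | false, true, t => (ramp t, hat t • zp)
  | true, false, t => (ramp (-t), hat t • zm)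

theorem edgeDatum_swap {k : ℕ} (zp zm : RR k) (a b : Bool) (t : ℝ) :
    edgeDatum zp zm b a t = edgeDatum zm zp a b (-t) := by
  cases a <;> cases b <;> simp [edgeDatum, hat_neg]

/-- Exchanging the two phases replaces ψ by 1/4 - ψ, z by -z and P by -P, whose extremal points are
the negatives in exchanged roles. -/
theorem edgeDatum_not {k : ℕ} (zp zm : RR k) (a b : Bool) (t : ℝ) :
    edgeDatum zp zm (!a) (!b) t =
      (1 / 4 - (edgeDatum (-zm) (-zp) a b t).1, -(edgeDatum (-zm) (-zp) a b t).2) := by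
  cases a <;> cases b <;> simp [edgeDatum, ramp_neg]

theorem edgeDatum_map {k : ℕ} (R : RR k ≃ₗᵢ[ℝ] RR k) (zp zm : RR k) (a b : Bool) (t : ℝ) :
    edgeDatum (R zp) (R zm) a b t = ((edgeDatum zp zm a b t).1, R (edgeDatum zp zm a b t).2) := by
  cases a <;> cases b <;> simp [edgeDatum]

theorem edgeDatum_self {k : ℕ} (zp zm : RR k) (a : Bool) (t : ℝ) :
    edgeDatum zp zm a a t = (if a then 1 / 4 else 0, 0) := by
  cases a <;> simp [edgeDatum]

theorem edgeDatum_left {k : ℕ} (zp zm : RR k) (a b : Bool) :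
    edgeDatum zp zm a b (-1 / 2) = (if a then 1 / 4 else 0, 0) := by
  have h : hat (-1 / 2) = 0 := hat_of_ge (by norm_num [abs_of_neg])
  have h1 : ramp (-1 / 2) = 0 := ramp_of_le (by norm_num)
  have h2 : ramp (-(-1 / 2)) = 1 / 4 := ramp_of_ge (by norm_num)
  cases a <;> cases b <;> simp only [edgeDatum, h, h1, h2] <;> simp

theorem edgeDatum_right {k : ℕ} (zp zm : RR k) (a b : Bool) :
    edgeDatum zp zm a b (1 / 2) = (if b then 1 / 4 else 0, 0) := by
  have h : hat (1 / 2) = 0 := hat_of_ge (by norm_num)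
  have h1 : ramp (1 / 2) = 1 / 4 := ramp_of_ge (by norm_num)
  have h2 : ramp (-(1 / 2)) = 0 := ramp_of_le (by norm_num)
  cases a <;> cases b <;> simp only [edgeDatum, h, h1, h2] <;> simp

theorem exists_lipschitzWith_edgeDatum {k : ℕ} (zp zm : RR k) (a b : Bool) :
    ∃ K, LipschitzWith K (edgeDatum zp zm a b) := by
  have hs : ∀ z : RR k, LipschitzWith (1 * 0 + 8 * ‖z‖₊) fun t => hat t • z := fun z =>
    lipschitzWith_smul_of_bounded lipschitzWith_hat (LipschitzWith.const z) abs_hat_le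
      fun _ => le_rfl
  cases a <;> cases b
  · exact ⟨0, LipschitzWith.const _⟩
  · exact ⟨_, lipschitzWith_ramp.prodMk (hs zp)⟩
  · exact ⟨_, (lipschitzWith_ramp.comp LipschitzWith.id.neg).prodMk (hs zm)⟩
  · exact ⟨0, LipschitzWith.const _⟩

theorem edgeDatum_fst_mem {k : ℕ} (zp zm : RR k) (a b : Bool) (t : ℝ) :
    0 ≤ (edgeDatum zp zm a b t).1 ∧ (edgeDatum zp zm a b t).1 ≤ 1 / 4 := by
  cases a <;> cases b <;> simp only [edgeDatum] <;>
    first | exact ⟨ramp_nonneg _, ramp_le _⟩ | norm_num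

/-- `zp` and `zm` maximize and minimize the `i`-th coordinate on `P`. -/
def IsAxisExtremal {k : ℕ} (P : Set (RR k)) (i : Fin k) (zp zm : RR k) : Prop :=
  zp ∈ P ∧ zm ∈ P ∧ ∀ ξ ∈ P, ξ i ≤ zp i ∧ zm i ≤ ξ i

theorem exists_isAxisExtremal {k : ℕ} {P : Set (RR k)} (hc : IsCompact P) (hne : P.Nonempty)
    (i : Fin k) : ∃ zp zm, IsAxisExtremal P i zp zm := by
  have hcont : Continuous fun x : RR k => x i := by fun_prop
  obtain ⟨zp, hzp, hp⟩ := hc.exists_isMaxOn hne hcont.continuousOn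
  obtain ⟨zm, hzm, hm⟩ := hc.exists_isMinOn hne hcont.continuousOn
  exact ⟨zp, zm, hzp, hzm, fun ξ hξ => ⟨hp hξ, hm hξ⟩⟩

theorem edgeDatum_snd_mem {k : ℕ} {P : Set (RR k)} (hP : Convex ℝ P) (h0 : 0 ∈ P) {zp zm : RR k}
    (hp : zp ∈ P) (hm : zm ∈ P) (a b : Bool) (t : ℝ) : (edgeDatum zp zm a b t).2 ∈ P := by
  cases a <;> cases b <;> simp only [edgeDatum] <;>
    first | exact h0 | exact hP.smul_mem_of_zero_mem h0 ‹_› ⟨hat_nonneg _, hat_le _⟩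

theorem calibratesAt_edgeDatum {k : ℕ} {P : Set (RR k)} {i : Fin k} {zp zm : RR k}
    (h : IsAxisExtremal P i zp zm) (a b : Bool) (x : RR k) :
    CalibratesAt P (fun y => (edgeDatum zp zm a b (y i)).1) (edgeDatum zp zm a b (x i)).2 x := by
  cases a <;> cases b <;> simp only [edgeDatum]
  · exact calibratesAt_of_isLocalMin (Filter.Eventually.of_forall fun y => le_rfl)
  · refine calibratesAt_ramp_comp (g := fun y => y i) (n := EuclideanSpace.single i 1)
      (fun _ y => by simp [EuclideanSpace.inner_single_left]) fun hx ξ hξ => ?_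
    simpa [EuclideanSpace.inner_single_right, hat_of_le hx.le] using (h.2.2 ξ hξ).1
  · refine calibratesAt_ramp_comp (g := fun y => -y i) (n := -EuclideanSpace.single i 1)
      (fun _ y => by simp [EuclideanSpace.inner_single_left]) fun hx ξ hξ => ?_
    rw [abs_neg] at hx
    simpa [EuclideanSpace.inner_single_right, hat_of_le hx.le] using (h.2.2 ξ hξ).2
  · exact calibratesAt_of_isLocalMin (Filter.Eventually.of_forall fun y => le_rfl)

/-! ### Models on a square cell -/

/-- A calibrated pair on the cell `[-1/2, 1/2]²` with prescribed data on the edges, determined by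
the marks `a`, `b`, `c`, `d` of the lower left, lower right, upper left and upper right vertex. -/
structure CellModel (P : Set (RR 2)) (zE zW zN zS : RR 2) (a b c d : Bool)
    (Φ : RR 2 → ℝ × RR 2) : Prop where
  lip : ∃ K, LipschitzWith K Φ
  fst_mem : ∀ x, 0 ≤ (Φ x).1 ∧ (Φ x).1 ≤ 1 / 4
  snd_mem : ∀ x, (Φ x).2 ∈ P
  calib : ∀ x, CalibratesAt P (fun y => (Φ y).1) (Φ x).2 x
  bottom : ∀ x, x 1 = -1 / 2 → Φ x = edgeDatum zE zW a b (x 0)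
  top : ∀ x, x 1 = 1 / 2 → Φ x = edgeDatum zE zW c d (x 0)
  left : ∀ x, x 0 = -1 / 2 → Φ x = edgeDatum zN zS a c (x 1)
  right : ∀ x, x 0 = 1 / 2 → Φ x = edgeDatum zN zS b d (x 1)
  const : a = b → a = c → a = d → ∀ x, Φ x = (if a then 1 / 4 else 0, 0)

/-- Cell models exist for the given marks, whatever the small convex body. -/
def HasCellModel (a b c d : Bool) : Prop :=
  ∀ P : Set (RR 2), IsCompact P → Convex ℝ P → 0 ∈ P → (∀ ξ ∈ P, ∀ i, |ξ i| ≤ 1 / 8) →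
    ∀ zE zW zN zS, IsAxisExtremal P 0 zE zW → IsAxisExtremal P 1 zN zS →
      ∃ Φ, CellModel P zE zW zN zS a b c d Φ

/-- The datum of the vertical edges, extended independently of the horizontal coordinate. -/
theorem hasCellModel_horizontal (a c : Bool) : HasCellModel a a c c := by
  intro P _ hP h0 _ zE zW zN zS _ hN
  obtain ⟨K, hK⟩ := exists_lipschitzWith_edgeDatum zN zS a c
  refine ⟨fun x => edgeDatum zN zS a c (x 1), ⟨_, hK.comp (lipschitzWith_coord 1)⟩,
    fun x => edgeDatum_fst_mem _ _ _ _ _, fun x => edgeDatum_snd_mem hP h0 hN.1 hN.2.1 _ _ _,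
    fun x => calibratesAt_edgeDatum hN a c x, ?_, ?_, fun _ _ => rfl, fun _ _ => rfl, ?_⟩
  · intro x hx
    rw [hx, edgeDatum_left, edgeDatum_self]
  · intro x hx
    rw [hx, edgeDatum_right, edgeDatum_self]
  · rintro - rfl - x
    exact edgeDatum_self _ _ _ _

theorem hasCellModel_corner : HasCellModel false true true true := by
  intro P hc hP h0 hs zE zW zN zS hE hN
  obtain ⟨ψ, z, ⟨K, hK⟩, ⟨L, hL⟩, h1, h2, h3, hb, hl, hr⟩ := exists_corner hc hP h0 hs hE.1 hN.1
    (fun ξ hξ => (hE.2.2 ξ hξ).1) fun ξ hξ => (hN.2.2 ξ hξ).1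
  refine ⟨fun x => (ψ x, z x), ⟨_, hK.prodMk hL⟩, h1, h2, h3, ?_, ?_, ?_, ?_, by simp⟩
  · intro x hx
    simp [edgeDatum, hb x hx.le]
  · intro x hx
    simp [edgeDatum, hr x (Or.inr hx.ge)]
  · intro x hx
    simp [edgeDatum, hl x hx.le]
  · intro x hx
    simp [edgeDatum, hr x (Or.inl hx.ge)]

/-! ### Complement and reflections of cell models -/

theorem HasCellModel.not {a b c d : Bool} (h : HasCellModel a b c d) :
    HasCellModel (!a) (!b) (!c) (!d) := by
  intro P hc hP h0 hs zE zW zN zS hE hN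
  have hext : ∀ {i : Fin 2} {zp zm : RR 2}, IsAxisExtremal P i zp zm →
      IsAxisExtremal (-P) i (-zm) (-zp) := fun {i zp zm} h =>
    ⟨by simpa using h.2.1, by simpa using h.1, fun ξ hξ => by
      have := h.2.2 (-ξ) hξ
      simp only [PiLp.neg_apply] at this ⊢
      constructor <;> linarith⟩
  obtain ⟨Φ, ⟨K, hK⟩, h1, h2, h3, hb, ht, hl, hr, hcst⟩ := h (-P) hc.neg hP.neg (by simpa using h0)
    (fun ξ hξ i => by simpa using hs (-ξ) hξ i) _ _ _ _ (hext hE) (hext hN)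
  refine ⟨fun x => (1 / 4 - (Φ x).1, -(Φ x).2), ⟨_, ((LipschitzWith.const (1 / 4 : ℝ)).sub
    (LipschitzWith.prod_fst.comp hK)).prodMk (LipschitzWith.prod_snd.comp hK).neg⟩,
    fun x => ?_, fun x => by simpa using h2 x, fun x => (h3 x).neg_left, ?_, ?_, ?_, ?_, ?_⟩
  · have := h1 x
    constructor <;> simp only <;> linarith
  · intro x hx; rw [edgeDatum_not, hb x hx]
  · intro x hx; rw [edgeDatum_not, ht x hx]
  · intro x hx; rw [edgeDatum_not, hl x hx]
  · intro x hx; rw [edgeDatum_not, hr x hx]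
  · intro hab hac had x
    rw [hcst (by simpa using hab) (by simpa using hac) (by simpa using had) x]
    cases a <;> simp

/-- The reflection of the plane in the `i`-th coordinate. -/
noncomputable def coordFlip (i : Fin 2) : RR 2 ≃ₗᵢ[ℝ] RR 2 :=
  LinearIsometryEquiv.piLpCongrRight 2 fun j =>
    if j = i then LinearIsometryEquiv.neg ℝ else LinearIsometryEquiv.refl ℝ ℝ

theorem coordFlip_self (i : Fin 2) (x : RR 2) : coordFlip i x i = -x i := by
  simp [coordFlip]

theorem coordFlip_of_ne {i j : Fin 2} (h : j ≠ i) (x : RR 2) : coordFlip i x j = x j := by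
  simp [coordFlip, h]

theorem coordFlip_coordFlip (i : Fin 2) (x : RR 2) : coordFlip i (coordFlip i x) = x := by
  ext j
  by_cases h : j = i
  · subst h; simp [coordFlip_self]
  · simp [coordFlip_of_ne h]

theorem IsAxisExtremal.flip_self {P : Set (RR 2)} {i : Fin 2} {zp zm : RR 2}
    (h : IsAxisExtremal P i zp zm) :
    IsAxisExtremal (coordFlip i '' P) i (coordFlip i zm) (coordFlip i zp) := by
  refine ⟨mem_image_of_mem _ h.2.1, mem_image_of_mem _ h.1, ?_⟩
  rintro - ⟨ξ, hξ, rfl⟩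
  simpa [coordFlip_self] using (h.2.2 ξ hξ).symm

theorem IsAxisExtremal.flip_of_ne {P : Set (RR 2)} {i j : Fin 2} (hij : j ≠ i) {zp zm : RR 2}
    (h : IsAxisExtremal P j zp zm) :
    IsAxisExtremal (coordFlip i '' P) j (coordFlip i zp) (coordFlip i zm) := by
  refine ⟨mem_image_of_mem _ h.1, mem_image_of_mem _ h.2.1, ?_⟩
  rintro - ⟨ξ, hξ, rfl⟩
  simpa [coordFlip_of_ne hij] using h.2.2 ξ hξ

theorem abs_coordFlip (i j : Fin 2) (x : RR 2) : |coordFlip i x j| = |x j| := by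
  by_cases h : j = i
  · subst h; simp [coordFlip_self]
  · simp [coordFlip_of_ne h]

theorem HasCellModel.flip_zero {a b c d : Bool} (h : HasCellModel a b c d) :
    HasCellModel b a d c := by
  intro P hc hP h0 hs zE zW zN zS hE hN
  have h10 : (1 : Fin 2) ≠ 0 := by decide
  set R := coordFlip 0 with hR
  have hRR : ∀ x, R (R x) = x := coordFlip_coordFlip 0
  obtain ⟨Φ, ⟨K, hK⟩, h1, h2, h3, hb, ht, hl, hr, hcst⟩ := h (R '' P)
    (hc.image R.continuous) (hP.linear_image R.toLinearEquiv.toLinearMap) ⟨0, h0, by simp⟩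
    (by rintro - ⟨ξ, hξ, rfl⟩ i; rw [abs_coordFlip]; exact hs ξ hξ i)
    _ _ _ _ hE.flip_self (hN.flip_of_ne h10)
  have e0 : ∀ x, R x 0 = -x 0 := coordFlip_self 0
  have e1 : ∀ x, R x 1 = x 1 := coordFlip_of_ne h10
  refine ⟨fun x => ((Φ (R x)).1, R (Φ (R x)).2), ⟨_, (LipschitzWith.prod_fst.comp
    (hK.comp R.lipschitz)).prodMk (R.lipschitz.comp
    (LipschitzWith.prod_snd.comp (hK.comp R.lipschitz)))⟩, fun x => h1 _, fun x => ?_,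
    fun x => ?_, ?_, ?_, ?_, ?_, ?_⟩
  · obtain ⟨ξ, hξ, h⟩ := h2 (R x)
    simp only [← h, hRR]
    exact hξ
  · exact CalibratesAt.comp_isometry (ψ := fun y => (Φ y).1) R (by rw [hRR]; exact h3 (R x))
  · intro x hx
    rw [hb (R x) (by rw [e1, hx]), edgeDatum_map, hRR, e0, edgeDatum_swap zE]
  · intro x hx
    rw [ht (R x) (by rw [e1, hx]), edgeDatum_map, hRR, e0, edgeDatum_swap zE]
  · intro x hx
    rw [hr (R x) (by rw [e0, hx]; norm_num), edgeDatum_map, hRR, e1]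
  · intro x hx
    rw [hl (R x) (by rw [e0, hx]; norm_num), edgeDatum_map, hRR, e1]
  · rintro rfl rfl rfl x
    rw [hcst rfl rfl rfl (R x)]
    simp

theorem HasCellModel.flip_one {a b c d : Bool} (h : HasCellModel a b c d) :
    HasCellModel c d a b := by
  intro P hc hP h0 hs zE zW zN zS hE hN
  have h01 : (0 : Fin 2) ≠ 1 := by decide
  set R := coordFlip 1 with hR
  have hRR : ∀ x, R (R x) = x := coordFlip_coordFlip 1
  obtain ⟨Φ, ⟨K, hK⟩, h1, h2, h3, hb, ht, hl, hr, hcst⟩ := h (R '' P)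
    (hc.image R.continuous) (hP.linear_image R.toLinearEquiv.toLinearMap) ⟨0, h0, by simp⟩
    (by rintro - ⟨ξ, hξ, rfl⟩ i; rw [abs_coordFlip]; exact hs ξ hξ i)
    _ _ _ _ (hE.flip_of_ne h01) hN.flip_self
  have e1 : ∀ x, R x 1 = -x 1 := coordFlip_self 1
  have e0 : ∀ x, R x 0 = x 0 := coordFlip_of_ne h01
  refine ⟨fun x => ((Φ (R x)).1, R (Φ (R x)).2), ⟨_, (LipschitzWith.prod_fst.comp
    (hK.comp R.lipschitz)).prodMk (R.lipschitz.comp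
    (LipschitzWith.prod_snd.comp (hK.comp R.lipschitz)))⟩, fun x => h1 _, fun x => ?_,
    fun x => ?_, ?_, ?_, ?_, ?_, ?_⟩
  · obtain ⟨ξ, hξ, h⟩ := h2 (R x)
    simp only [← h, hRR]
    exact hξ
  · exact CalibratesAt.comp_isometry (ψ := fun y => (Φ y).1) R (by rw [hRR]; exact h3 (R x))
  · intro x hx
    rw [ht (R x) (by rw [e1, hx]; norm_num), edgeDatum_map, hRR, e0]
  · intro x hx
    rw [hb (R x) (by rw [e1, hx]; norm_num), edgeDatum_map, hRR, e0]
  · intro x hx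
    rw [hl (R x) (by rw [e0, hx]), edgeDatum_map, hRR, e1, edgeDatum_swap zN]
  · intro x hx
    rw [hr (R x) (by rw [e0, hx]), edgeDatum_map, hRR, e1, edgeDatum_swap zN]
  · rintro rfl rfl rfl x
    rw [hcst rfl rfl rfl (R x)]
    simp

/-- Twelve markings are allowed: four with `a = b` and `c = d`, and eight with one exceptional
vertex. The eight are the images of one corner under the reflections and the complement. -/
theorem hasCellModel_of_eq_or_eq {a b c d : Bool} (h : a = b ∨ c = d) : HasCellModel a b c d := by
  have h1 := hasCellModel_corner
  have h2 := h1.flip_zero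
  have h3 := h1.flip_one
  have h4 := h2.flip_one
  have g1 := h1.not
  have g2 := h2.not
  have g3 := h3.not
  have g4 := h4.not
  simp only [Bool.not_true, Bool.not_false] at g1 g2 g3 g4
  cases a <;> cases b <;> cases c <;> cases d <;>
    first | exact hasCellModel_horizontal _ _ | assumption | simp at h

/-! ### The construction on the integer lattice -/

/-- The coordinates of a point relative to the centre of the unit cell with lower left vertex `v`,
clamped to the cell. -/
noncomputable def cellMap {k : ℕ} (v : Fin k → ℤ) (x : RR k) : RR k :=
  WithLp.toLp 2 fun i => max (-1 / 2) (min (x i - v i - 1 / 2) (1 / 2))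

theorem lipschitzWith_cellMap {k : ℕ} (v : Fin k → ℤ) : LipschitzWith 1 (cellMap v) := by
  refine lipschitzWith_coordinatewise
    (φ := fun i t => max (-1 / 2) (min (t - v i - 1 / 2) (1 / 2))) fun i => ?_
  have h : LipschitzWith 1 fun t : ℝ => t - v i - 1 / 2 :=
    LipschitzWith.of_dist_le_mul fun x y => by simp
  exact (h.min_const _).const_max _

theorem cellMap_apply {k : ℕ} (v : Fin k → ℤ) (x : RR k) (i : Fin k) :
    cellMap v x i = max (-1 / 2) (min (x i - v i - 1 / 2) (1 / 2)) := rfl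

theorem cellMap_of_eq_add_one {k : ℕ} {v : Fin k → ℤ} {x : RR k} {i : Fin k}
    (h : x i = v i + 1) : cellMap v x i = 1 / 2 := by
  rw [cellMap_apply, h]; norm_num

theorem cellMap_of_eq {k : ℕ} {v : Fin k → ℤ} {x : RR k} {i : Fin k}
    (h : x i = v i) : cellMap v x i = -1 / 2 := by
  rw [cellMap_apply, h]; norm_num

/-- Off the lattice hyperplanes the clamping is locally inactive, so the glued pair is locally a
translate of one cell model and inherits its calibration. -/
theorem eventually_cellMap {k : ℕ} {x : RR k} (hx : ∀ i (m : ℤ), x i ≠ (m : ℝ)) :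
    ∀ᶠ y in 𝓝 x, (∀ i, ⌊y i⌋ = ⌊x i⌋) ∧
      cellMap (fun i => ⌊x i⌋) y = y + WithLp.toLp 2 fun i => -(⌊x i⌋ : ℝ) - 1 / 2 := by
  have h : ∀ᶠ y in 𝓝 x, ∀ i, (⌊x i⌋ : ℝ) < y i ∧ y i < (⌊x i⌋ : ℝ) + 1 := by
    refine Filter.eventually_all.2 fun i => ?_
    have hc : ContinuousAt (fun y : RR k => y i) x := by fun_prop
    exact (continuousAt_const.eventually_lt hc ((Int.floor_le _).lt_of_ne (hx i _).symm)).and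
      (hc.eventually_lt continuousAt_const (Int.lt_floor_add_one _))
  filter_upwards [h] with y hy
  refine ⟨fun i => Int.floor_eq_iff.2 ⟨(hy i).1.le, (hy i).2⟩, ?_⟩
  ext i
  have := hy i
  rw [cellMap_apply, min_eq_left (by linarith), max_eq_right (by linarith)]
  simp only [PiLp.add_apply]
  ring

/-- The lattice version of the main construction: any marking of the integer lattice, after a
modification `b` that moves lattice points by at most one, bounds a calibrated pair. -/
def LatticeCalibration (k : ℕ) : Prop :=
  ∃ b : (Fin k → ℤ) → Fin k → ℤ, (∀ v i, |b v i - v i| ≤ 1) ∧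
    ∀ P : Set (RR k), IsCompact P → Convex ℝ P → 0 ∈ P → (∀ ξ ∈ P, ∀ i, |ξ i| ≤ 1 / 8) →
    ∀ τ : (Fin k → ℤ) → Bool, ∃ (ψ : RR k → ℝ) (z : RR k → RR k),
      (∃ K, LipschitzWith K ψ) ∧ (∃ K, LipschitzWith K z) ∧ (∀ x, 0 ≤ ψ x) ∧ (∀ x, z x ∈ P) ∧
      (∀ x, (∀ i (m : ℤ), x i ≠ (m : ℝ)) → CalibratesAt P ψ (z x) x) ∧
      ∀ x (c : Bool), (∀ v : Fin k → ℤ, (∀ i, v i = ⌊x i⌋ ∨ v i = ⌊x i⌋ + 1) → τ (b v) = c) →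
        ψ x = (if c then 1 / 4 else 0) ∧ z x = 0

theorem latticeCalibration_one : LatticeCalibration 1 := by
  refine ⟨id, fun v i => by simp, fun P hc hP h0 hs τ => ?_⟩
  obtain ⟨zE, zW, hE⟩ := exists_isAxisExtremal hc ⟨0, h0⟩ 0
  set s : ℤ → Bool := fun m => τ fun _ => m with hsdef
  have hK : ∀ a b, ∃ K, LipschitzWith K (edgeDatum zE zW a b) :=
    exists_lipschitzWith_edgeDatum zE zW
  choose K hK using hK
  obtain ⟨M, hM⟩ := Finite.exists_le fun p : Bool × Bool => K p.1 p.2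
  set f : ℤ → RR 1 → ℝ × RR 1 := fun m x =>
    edgeDatum zE zW (s m) (s (m + 1)) (cellMap (fun _ => m) x 0) with hf
  have hfL : ∀ m, LipschitzWith (M * (1 * 1)) (f m) := fun m =>
    ((hK _ _).weaken (hM (s m, s (m + 1)))).comp
      ((lipschitzWith_coord 0).comp (lipschitzWith_cellMap _))
  have hF := lipschitzWith_glue 0 hfL fun m x hx => by
    simp only [hf]
    rw [cellMap_of_eq_add_one (v := fun _ => m) hx,
      cellMap_of_eq (v := fun _ => m + 1) (by rw [hx]; push_cast; rfl),
      edgeDatum_right, edgeDatum_left]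
  refine ⟨fun x => (f ⌊x 0⌋ x).1, fun x => (f ⌊x 0⌋ x).2, ⟨_, LipschitzWith.prod_fst.comp hF⟩,
    ⟨_, LipschitzWith.prod_snd.comp hF⟩, fun x => (edgeDatum_fst_mem _ _ _ _ _).1,
    fun x => edgeDatum_snd_mem hP h0 hE.1 hE.2.1 _ _ _, fun x hx => ?_, fun x c hc => ?_⟩
  · have hv : (fun i : Fin 1 => ⌊x i⌋) = fun _ => ⌊x 0⌋ := by
      ext i; rw [Subsingleton.elim i 0]
    have he := eventually_cellMap hx
    rw [hv] at he
    have hx' : f ⌊x 0⌋ x = edgeDatum zE zW (s ⌊x 0⌋) (s (⌊x 0⌋ + 1))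
        ((x + WithLp.toLp 2 fun i => -(⌊x i⌋ : ℝ) - 1 / 2) 0) := by
      simp only [hf, he.self_of_nhds.2]
    beta_reduce
    rw [hx']
    refine ((calibratesAt_edgeDatum hE _ _ _).comp_add_const).congr ?_
    filter_upwards [he] with y hy
    rw [hy.1 0]
    simp only [hf, hy.2]
  · have h1 : s ⌊x 0⌋ = c := hc _ fun i => Or.inl (by fin_cases i; rfl)
    have h2 : s (⌊x 0⌋ + 1) = c := hc _ fun i => Or.inr (by fin_cases i; rfl)
    simp only [hf, h1, h2, edgeDatum_self, and_self]

theorem latticeCalibration_two : LatticeCalibration 2 := by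
  -- A site with odd coordinate sum copies the mark of its left neighbour. The resulting dominoes
  -- shift by one from row to row, so every cell has a domino as its bottom or its top edge.
  set b : (Fin 2 → ℤ) → Fin 2 → ℤ := fun v =>
    if Even (v 0 + v 1) then v else ![v 0 - 1, v 1] with hb
  refine ⟨b, fun v i => ?_, fun P hc hP h0 hs τ => ?_⟩
  · simp only [hb]
    split_ifs
    · simp
    · fin_cases i <;> simp
  obtain ⟨zE, zW, hE⟩ := exists_isAxisExtremal hc ⟨0, h0⟩ 0
  obtain ⟨zN, zS, hN⟩ := exists_isAxisExtremal hc ⟨0, h0⟩ 1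
  set s : ℤ → ℤ → Bool := fun m n => τ (b ![m, n]) with hsdef
  have hdiag : ∀ m n, s m n = s (m + 1) n ∨ s m (n + 1) = s (m + 1) (n + 1) := by
    intro m n
    rcases Int.even_or_odd (m + n) with h | h
    · left
      have h' : ¬ Even (m + 1 + n) := by
        rw [Int.not_even_iff_odd, add_right_comm]; exact h.add_one
      simp [hsdef, hb, h, h']
    · right
      have h1 : Even (m + (n + 1)) := by rw [← add_assoc]; exact h.add_one
      have h2 : ¬ Even (m + 1 + (n + 1)) := by
        rw [Int.not_even_iff_odd, add_right_comm]; exact h1.add_one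
      simp [hsdef, hb, h1, h2]
  -- Choosing one model per marking, with a dummy for the excluded ones, allows a Lipschitz constant
  -- uniform over all cells.
  have hmodel : ∀ a b c d, ∃ Φ, a = b ∨ c = d → CellModel P zE zW zN zS a b c d Φ := by
    intro a b c d
    by_cases h : a = b ∨ c = d
    · obtain ⟨Φ, hΦ⟩ := hasCellModel_of_eq_or_eq h P hc hP h0 hs zE zW zN zS hE hN
      exact ⟨Φ, fun _ => hΦ⟩
    · exact ⟨fun _ => 0, fun h' => absurd h' h⟩
  choose Φ hΦ using hmodel
  have hΦL : ∀ a b c d, ∃ K, a = b ∨ c = d → LipschitzWith K (Φ a b c d) := by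
    intro a b c d
    by_cases h : a = b ∨ c = d
    · obtain ⟨K, hK⟩ := (hΦ a b c d h).lip
      exact ⟨K, fun _ => hK⟩
    · exact ⟨0, fun h' => absurd h' h⟩
  choose K hK using hΦL
  obtain ⟨M, hM⟩ := Finite.exists_le fun p : Bool × Bool × Bool × Bool => K p.1 p.2.1 p.2.2.1 p.2.2.2
  set Ψ : ℤ → ℤ → RR 2 → ℝ × RR 2 := fun m n =>
    Φ (s m n) (s (m + 1) n) (s m (n + 1)) (s (m + 1) (n + 1)) with hΨ
  have hmod : ∀ m n, CellModel P zE zW zN zS (s m n) (s (m + 1) n) (s m (n + 1))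
      (s (m + 1) (n + 1)) (Ψ m n) := fun m n => hΦ _ _ _ _ (hdiag m n)
  set f : ℤ → ℤ → RR 2 → ℝ × RR 2 := fun n m x => Ψ m n (cellMap ![m, n] x) with hf
  have hfL : ∀ n m, LipschitzWith (M * 1) (f n m) := fun n m =>
    ((hK _ _ _ _ (hdiag m n)).weaken (hM (_, _, _, _))).comp (lipschitzWith_cellMap _)
  have hrow : ∀ n, LipschitzWith (M * 1) fun x : RR 2 => f n ⌊x 0⌋ x := fun n =>
    lipschitzWith_glue 0 (hfL n) fun m x hx => by
      simp only [hf]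
      rw [(hmod m n).right _ (cellMap_of_eq_add_one (by simpa using hx)),
        (hmod (m + 1) n).left _ (cellMap_of_eq (by simpa using hx))]
      simp [cellMap_apply]
  have hF := lipschitzWith_glue 1 hrow fun n x hx => by
    simp only [hf]
    rw [(hmod _ n).top _ (cellMap_of_eq_add_one (by simpa using hx)),
      (hmod _ (n + 1)).bottom _ (cellMap_of_eq (by simpa using hx))]
    simp [cellMap_apply]
  refine ⟨fun x => (f ⌊x 1⌋ ⌊x 0⌋ x).1, fun x => (f ⌊x 1⌋ ⌊x 0⌋ x).2,
    ⟨_, LipschitzWith.prod_fst.comp hF⟩, ⟨_, LipschitzWith.prod_snd.comp hF⟩,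
    fun x => ((hmod _ _).fst_mem _).1, fun x => (hmod _ _).snd_mem _, fun x hx => ?_,
    fun x c hc => ?_⟩
  · have hv : (fun i : Fin 2 => ⌊x i⌋) = ![⌊x 0⌋, ⌊x 1⌋] := by
      ext i; fin_cases i <;> rfl
    have he := eventually_cellMap hx
    rw [hv] at he
    have hx' : f ⌊x 1⌋ ⌊x 0⌋ x = Ψ ⌊x 0⌋ ⌊x 1⌋
        (x + WithLp.toLp 2 fun i => -(⌊x i⌋ : ℝ) - 1 / 2) := by
      simp only [hf, he.self_of_nhds.2]
    beta_reduce
    rw [hx']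
    refine (((hmod _ _).calib _).comp_add_const).congr ?_
    filter_upwards [he] with y hy
    rw [hy.1 0, hy.1 1]
    simp only [hf, hy.2]
  · have hm : ∀ m n, (m = ⌊x 0⌋ ∨ m = ⌊x 0⌋ + 1) → (n = ⌊x 1⌋ ∨ n = ⌊x 1⌋ + 1) → s m n = c :=
      fun m n h h' => hc _ fun i => by
        fin_cases i
        · exact h
        · exact h'
    have h00 := hm _ _ (Or.inl rfl) (Or.inl rfl)
    have h10 := hm _ _ (Or.inr rfl) (Or.inl rfl)
    have h01 := hm _ _ (Or.inl rfl) (Or.inr rfl)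
    have h11 := hm _ _ (Or.inr rfl) (Or.inr rfl)
    have := (hmod ⌊x 0⌋ ⌊x 1⌋).const (h00.trans h10.symm) (h00.trans h01.symm)
      (h00.trans h11.symm) (cellMap ![⌊x 0⌋, ⌊x 1⌋] x)
    simp only [hf, this, h00, and_self]

/-! ### Rescaled calibrations around arbitrary sets -/

theorem norm_le_of_coord_le {k : ℕ} {x : RR k} {c : ℝ} (hx : ∀ i, |x i| ≤ c) :
    ‖x‖ ≤ k * c := by
  rcases Nat.eq_zero_or_pos k with rfl | hk
  · simp [EuclideanSpace.norm_eq]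
  have hc : 0 ≤ c := (abs_nonneg _).trans (hx ⟨0, hk⟩)
  have hk1 : (1 : ℝ) ≤ k := by exact_mod_cast hk
  rw [EuclideanSpace.norm_eq]
  refine Real.sqrt_le_iff.2 ⟨by positivity, ?_⟩
  calc ∑ i, ‖x i‖ ^ 2 ≤ ∑ _i : Fin k, c ^ 2 :=
        Finset.sum_le_sum fun i _ => pow_le_pow_left₀ (norm_nonneg _) (hx i) 2
    _ = k * c ^ 2 := by simp
    _ ≤ (k * c) ^ 2 := by
        rw [mul_pow]
        exact mul_le_mul_of_nonneg_right (by nlinarith) (by positivity)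

theorem ae_coord_ne {k : ℕ} (i : Fin k) (c : ℝ) : ∀ᵐ x : RR k, x i ≠ c :=
  (PiLp.volume_preserving_ofLp (Fin k)).quasiMeasurePreserving.ae 
    (Measure.ae_eval_ne (fun _ => volume) i c)

/-- Normal cones are invariant under positive multiples of the gradient and under dilating the body
together with its base point. -/
theorem CalibratesAt.comp_smul {k : ℕ} {P : Set (RR k)} {ψ : RR k → ℝ} {ζ x : RR k} {a c : ℝ}
    (ha : 0 < a) (hc : 0 < c) (h : CalibratesAt (a • P) ψ ζ (c • x)) :
    CalibratesAt P (fun y => ψ (c • y)) (a⁻¹ • ζ) x := by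
  intro p hp ξ hξ
  have h1 : HasGradientAt ψ (c⁻¹ • p) (c • x) := by
    rw [hasGradientAt_iff_hasFDerivAt] at hp ⊢
    have h2 : HasFDerivAt (fun y => ψ (c • y)) (InnerProductSpace.toDual ℝ (RR k) p)
        (c⁻¹ • c • x) := by rwa [inv_smul_smul₀ hc.ne']
    have h3 : HasFDerivAt (fun y : RR k => c⁻¹ • y)
        (c⁻¹ • ContinuousLinearMap.id ℝ (RR k)) (c • x) := (hasFDerivAt_id _).const_smul c⁻¹
    have h4 := h2.comp (c • x) h3
    have h5 : (fun y => ψ (c • y)) ∘ (fun y : RR k => c⁻¹ • y) = ψ := by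
      ext y; simp [smul_inv_smul₀ hc.ne']
    rw [h5] at h4
    have h6 : InnerProductSpace.toDual ℝ (RR k) (c⁻¹ • p) =
        (InnerProductSpace.toDual ℝ (RR k) p).comp (c⁻¹ • ContinuousLinearMap.id ℝ (RR k)) := by
      ext y; simp
    rwa [h6]
  have h2 := h _ h1 (a • ξ) (smul_mem_smul_set hξ)
  rw [real_inner_smul_left, real_inner_smul_right, real_inner_smul_right] at h2
  rw [real_inner_smul_left]
  have h3 : c⁻¹ * (a * inner ℝ ξ p) ≤ c⁻¹ * inner ℝ ζ p := by linarith
  have h4 := le_of_mul_le_mul_left h3 (inv_pos.2 hc)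
  rw [inv_mul_eq_div, le_div_iff₀ ha]
  linarith

/-- Around any set that is bounded or has bounded complement there is a calibrated pair whose
support function is positive on the set and which vanishes at distance `ε` from the set. -/
theorem LatticeCalibration.exists_calibration {k : ℕ} (hk : LatticeCalibration k)
    {P : Set (RR k)} (hc : IsCompact P) (hP : Convex ℝ P) (h0 : 0 ∈ P) (E : Set (RR k))
    (hE : Bornology.IsBounded E ∨ Bornology.IsBounded Eᶜ) {ε : ℝ} (hε : 0 < ε) :
    ∃ (ψ : RR k → ℝ) (z : RR k → RR k), (∃ K, LipschitzWith K ψ) ∧ (∃ K, LipschitzWith K z) ∧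
      (∀ x, 0 ≤ ψ x) ∧ (∀ x, z x ∈ P) ∧ (∀ᵐ x, CalibratesAt P ψ (z x) x) ∧
      (∀ x ∈ E, 0 < ψ x) ∧ (∀ x, (ψ x ≠ 0 ∨ z x ≠ 0) → ∃ e ∈ E, dist x e ≤ ε) ∧
      HasCompactSupport z := by
  obtain ⟨b, hb, hk⟩ := hk
  obtain ⟨R, hR0, hR⟩ := hc.isBounded.exists_pos_norm_le
  set a : ℝ := 1 / (8 * R) with ha
  have hapos : 0 < a := by positivity
  -- The mesh makes `4kh ≤ ε`; `k + 1` keeps it positive even for `k = 0`.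
  set h : ℝ := ε / (4 * (k + 1)) with hh
  have hpos : 0 < h := by positivity
  have hhk : 4 * (k * h) ≤ ε := by
    have : 4 * ((k + 1) * h) = ε := by rw [hh]; field_simp
    nlinarith
  classical
  -- A vertex of the cell of x, moved by `b`, differs from x by at most `2h` in each coordinate. So
  -- cells meeting `E` are marked true throughout, and one true mark puts x within `4kh` of `E`.
  set τ : (Fin k → ℤ) → Bool := fun u =>
    decide (∃ e ∈ E, dist e (h • (WithLp.toLp 2 fun i => (u i : ℝ) : RR k)) ≤ k * (2 * h)) with hτ
  have hP'small : ∀ ξ ∈ a • P, ∀ i, |ξ i| ≤ 1 / 8 := by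
    rintro - ⟨ξ, hξ, rfl⟩ i
    have h1 : |ξ i| ≤ R := (PiLp.norm_apply_le ξ i).trans (hR ξ hξ)
    simp only [PiLp.smul_apply, smul_eq_mul, abs_mul, abs_of_pos hapos]
    calc a * |ξ i| ≤ a * R := mul_le_mul_of_nonneg_left h1 hapos.le
      _ = 1 / 8 := by rw [ha]; field_simp
  obtain ⟨ψ, z, ⟨K, hK⟩, ⟨L, hL⟩, hψ0, hzP, hcal, hconst⟩ :=
    hk (a • P) (hc.smul a) (hP.smul a) ⟨0, h0, by simp⟩ hP'small τ
  have hdist : ∀ (x : RR k) (v : Fin k → ℤ),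
      (∀ i, v i = ⌊(h⁻¹ • x) i⌋ ∨ v i = ⌊(h⁻¹ • x) i⌋ + 1) →
      dist x (h • (WithLp.toLp 2 fun i => (b v i : ℝ) : RR k)) ≤ k * (2 * h) := by
    intro x v hv
    rw [dist_eq_norm]
    refine norm_le_of_coord_le fun i => ?_
    have h1 : x i = h * (h⁻¹ • x) i := by simp [hpos.ne']
    have h2 : |(h⁻¹ • x) i - v i| ≤ 1 := by
      have h3 := Int.floor_le ((h⁻¹ • x) i)
      have h4 := Int.lt_floor_add_one ((h⁻¹ • x) i)
      rw [abs_le]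
      rcases hv i with h5 | h5 <;> rw [h5] <;> push_cast <;> constructor <;> linarith
    have h3 : |(b v i : ℝ) - v i| ≤ 1 := by exact_mod_cast hb v i
    have h4 : |(h⁻¹ • x) i - b v i| ≤ 2 := by
      rw [abs_le] at h2 h3 ⊢
      constructor <;> linarith [h2.1, h2.2, h3.1, h3.2]
    have h5 : (x - h • (WithLp.toLp 2 fun i => (b v i : ℝ) : RR k)) i =
        h * ((h⁻¹ • x) i - b v i) := by
      rw [mul_sub, ← h1]; simp
    rw [h5, abs_mul, abs_of_pos hpos]
    nlinarith
  have htrue : ∀ x ∈ E, ψ (h⁻¹ • x) = 1 / 4 ∧ z (h⁻¹ • x) = 0 := by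
    intro x hx
    have := hconst (h⁻¹ • x) true fun v hv => by
      rw [hτ, decide_eq_true_iff]
      exact ⟨x, hx, hdist x v hv⟩
    simpa using this
  have hfalse : ∀ x, (∀ e ∈ E, ε < dist x e) → ψ (h⁻¹ • x) = 0 ∧ z (h⁻¹ • x) = 0 := by
    intro x hx
    have := hconst (h⁻¹ • x) false fun v hv => by
      rw [hτ, decide_eq_false_iff_not]
      rintro ⟨e, he, hd⟩
      have h1 := hdist x v hv
      have h2 := dist_triangle_right x e (h • (WithLp.toLp 2 fun i => (b v i : ℝ) : RR k))
      linarith [hx e he]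
    simpa using this
  have hsmulL : LipschitzWith (‖h⁻¹‖₊) fun x : RR k => h⁻¹ • x := lipschitzWith_smul h⁻¹
  have hnear : ∀ x, (ψ (h⁻¹ • x) ≠ 0 ∨ a⁻¹ • z (h⁻¹ • x) ≠ 0) → ∃ e ∈ E, dist x e ≤ ε := by
    intro x hx
    by_contra! hcon
    obtain ⟨h1, h2⟩ := hfalse x hcon
    simp [h1, h2] at hx
  refine ⟨fun x => ψ (h⁻¹ • x), fun x => a⁻¹ • z (h⁻¹ • x), ⟨_, hK.comp hsmulL⟩,
    ⟨_, (lipschitzWith_smul a⁻¹).comp (hL.comp hsmulL)⟩, fun x => hψ0 _, fun x => ?_, ?_, ?_,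
    hnear, ?_⟩
  · obtain ⟨ξ, hξ, he⟩ := hzP (h⁻¹ • x)
    simp only [← he, inv_smul_smul₀ hapos.ne']
    exact hξ
  · have hne : ∀ᵐ x : RR k, ∀ i, ∀ m : ℤ, x i ≠ h * m :=
      ae_all_iff.2 fun i => ae_all_iff.2 fun m => ae_coord_ne i _
    filter_upwards [hne] with x hx
    refine (hcal _ fun i m hm => hx i m ?_).comp_smul hapos (inv_pos.2 hpos)
    rw [← hm]; simp [hpos.ne']
  · intro x hx
    simp only [(htrue x hx).1]
    norm_num
  · have hbdd : ∃ B : Set (RR k), Bornology.IsBounded B ∧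
        Function.support (fun x => a⁻¹ • z (h⁻¹ • x)) ⊆ B := by
      -- If only the complement of `E` is bounded, the support of the field is still bounded,
      -- because the field vanishes on `E`.
      rcases hE with hE | hE
      · refine ⟨_, hE.cthickening (δ := ε), fun x hx => ?_⟩
        obtain ⟨e, he, hd⟩ := hnear x (Or.inr hx)
        exact Metric.mem_cthickening_of_dist_le x e ε E he hd
      · refine ⟨_, hE, fun x hx hxE => hx ?_⟩
        simp [(htrue x hxE).2]
    obtain ⟨B, hB, hsub⟩ := hbdd
    exact HasCompactSupport.of_support_subset_isCompact hB.isCompact_closure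
      (hsub.trans subset_closure)

/-! ### The divergence of a Lipschitz vector field -/

theorem gradient_coord {k : ℕ} {φ : RR k → ℝ} {x : RR k} (h : DifferentiableAt ℝ φ x) (i : Fin k) :
    gradient φ x i = lineDeriv ℝ φ x (EuclideanSpace.single i 1) := by
  rw [h.lineDeriv_eq_fderiv, h.hasGradientAt.fderiv_apply, EuclideanSpace.inner_single_right,
    one_mul]
  rfl

/-- The line derivatives of a Lipschitz field are bounded, and they vanish off the compact support
of `w` since `a` is constant, so they are square integrable. Integration by parts for Lipschitz
functions does the rest. -/
theorem exists_hasWeakDivOn {k : ℕ} {w : RR k → RR k} {K : ℝ≥0} (hw : LipschitzWith K w)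
    (hs : HasCompactSupport w) (a : RR k) :
    ∃ g : RR k → ℝ, MemLp g 2 (volume.restrict univ) ∧ HasWeakDivOn (fun x => w x + a) g univ := by
  have hL : ∀ i, LipschitzWith K fun x => (w x + a) i := fun i =>
    LipschitzWith.of_dist_le_mul fun x y => by
      have := (lipschitzWith_coord i).dist_le_mul (w x + a) (w y + a)
      rw [NNReal.coe_one, one_mul, dist_add_right] at this
      exact this.trans (hw.dist_le_mul x y)
  refine ⟨fun x => ∑ i, lineDeriv ℝ (fun y => (w y + a) i) x (EuclideanSpace.single i 1), ?_, ?_⟩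
  · rw [Measure.restrict_univ]
    refine memLp_finsetSum _ fun i _ => ?_
    have h1 := (hL i).memLp_lineDeriv (μ := volume) (EuclideanSpace.single i 1)
    have h2 : (fun x => lineDeriv ℝ (fun y => (w y + a) i) x (EuclideanSpace.single i 1)) =
        (tsupport w).indicator
          fun x => lineDeriv ℝ (fun y => (w y + a) i) x (EuclideanSpace.single i 1) := by
      refine (indicator_eq_self.2 fun x hx => ?_).symm
      by_contra hxs
      refine hx ?_
      have : (fun y => (w y + a) i) =ᶠ[𝓝 x] fun _ => a i := by
        filter_upwards [notMem_tsupport_iff_eventuallyEq.1 hxs] with y hy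
        simp [hy]
      beta_reduce
      rw [this.lineDeriv_eq]
      simp [lineDeriv]
    rw [h2, memLp_indicator_iff_restrict (isClosed_tsupport w).measurableSet]
    have : IsFiniteMeasure (volume.restrict (tsupport w)) :=
      ⟨by simpa using IsCompact.measure_lt_top hs⟩
    exact (h1.mono_measure Measure.restrict_le_self).mono_exponent le_top
  · intro φ hφ hφs _
    obtain ⟨D, hD⟩ := ContDiff.lipschitzWith_of_hasCompactSupport hφs hφ (by simp)
    have hdiff : Differentiable ℝ φ := hφ.differentiable (by simp)
    have e1 : ∀ x, (inner ℝ (w x + a) (gradient φ x) : ℝ) =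
        ∑ i, lineDeriv ℝ φ x (EuclideanSpace.single i 1) * (w x + a) i := fun x => by
      simp only [PiLp.inner_apply, gradient_coord (hdiff x)]
      rfl
    have hint1 : ∀ i, Integrable fun x =>
        lineDeriv ℝ φ x (EuclideanSpace.single i 1) * (w x + a) i := by
      intro i
      have hc : Continuous fun x => lineDeriv ℝ φ x (EuclideanSpace.single i 1) := by
        simp only [(hdiff _).lineDeriv_eq_fderiv]
        exact (hφ.continuous_fderiv (by simp)).clm_apply continuous_const
      refine (hc.mul (hL i).continuous).integrable_of_hasCompactSupport
        (HasCompactSupport.mul_right ?_)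
      simp only [(hdiff _).lineDeriv_eq_fderiv]
      exact (hφs.fderiv (𝕜 := ℝ)).comp_left
        (g := fun A : RR k →L[ℝ] ℝ => A (EuclideanSpace.single i 1)) rfl
    have hint2 : ∀ i, Integrable fun x =>
        lineDeriv ℝ (fun y => (w y + a) i) x (EuclideanSpace.single i 1) * φ x := fun i =>
      ((hL i).locallyIntegrable_lineDeriv _).integrable_smul_right_of_hasCompactSupport
        hφ.continuous hφs
    rw [Measure.restrict_univ]
    simp_rw [e1, Finset.sum_mul]
    rw [integral_finsetSum _ fun i _ => hint1 i, integral_finsetSum _ fun i _ => hint2 i,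
      ← Finset.sum_neg_distrib]
    refine Finset.sum_congr rfl fun i _ => ?_
    rw [(hL i).integral_lineDeriv_mul_eq hD hφs]
    simp only [lineDeriv_neg, neg_mul, integral_neg, neg_neg]

/-! ### Generalized neighborhoods -/

theorem mem_gnbd_of_nonneg {k : ℕ} {ρ : ℝ} (hρ : 0 ≤ ρ) {E : Set (RR k)} {x : RR k} :
    x ∈ gnbd ρ E ↔ ∃ e ∈ E, dist x e ≤ ρ := by
  rcases hρ.eq_or_lt with rfl | h
  · simp [gnbd]
  · simp only [gnbd, if_pos h, mem_add]
    constructor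
    · rintro ⟨e, he, c, hc, rfl⟩
      exact ⟨e, he, by simpa [dist_eq_norm] using hc⟩
    · rintro ⟨e, he, hd⟩
      exact ⟨e, he, x - e, by simpa [dist_eq_norm] using hd, by simp⟩

theorem mem_gnbd_neg_of_nonneg {k : ℕ} {ρ : ℝ} (hρ : 0 ≤ ρ) {E : Set (RR k)} {x : RR k} :
    x ∈ gnbd (-ρ) E ↔ Metric.closedBall x ρ ⊆ E := by
  rcases hρ.eq_or_lt with rfl | h
  · simp [gnbd]
  · have h1 : ¬ 0 < -ρ := by linarith
    have h2 : ¬ -ρ = 0 := by linarith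
    simp only [gnbd, if_neg h1, if_neg h2, abs_neg, abs_of_pos h]
    exact ⟨fun hx => hx.2, fun hx => ⟨hx (Metric.mem_closedBall_self h.le), hx⟩⟩

theorem isBounded_compl_gnbd_neg {k : ℕ} {ρ : ℝ} (hρ : 0 ≤ ρ) {E : Set (RR k)}
    (h : Bornology.IsBounded Eᶜ) : Bornology.IsBounded (gnbd (-ρ) E)ᶜ := by
  refine (h.cthickening (δ := ρ)).subset fun x hx => ?_
  rw [mem_compl_iff, mem_gnbd_neg_of_nonneg hρ, not_subset] at hx
  obtain ⟨y, hy, hyE⟩ := hx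
  exact Metric.mem_cthickening_of_dist_le x y ρ _ hyE (by rwa [dist_comm])

theorem isBounded_gnbd {k : ℕ} {ρ : ℝ} (hρ : 0 ≤ ρ) {E : Set (RR k)}
    (h : Bornology.IsBounded E) : Bornology.IsBounded (gnbd ρ E) := by
  refine (h.cthickening (δ := ρ)).subset fun x hx => ?_
  obtain ⟨e, he, hd⟩ := (mem_gnbd_of_nonneg hρ).1 hx
  exact Metric.mem_cthickening_of_dist_le x e ρ _ he hd

theorem subset_gnbd {k : ℕ} {ρ : ℝ} (hρ : 0 ≤ ρ) (E : Set (RR k)) : E ⊆ gnbd ρ E := fun x hx =>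
  (mem_gnbd_of_nonneg hρ).2 ⟨x, hx, by simpa⟩

theorem gnbd_neg_subset {k : ℕ} {ρ : ℝ} (hρ : 0 ≤ ρ) (E : Set (RR k)) : gnbd (-ρ) E ⊆ E :=
  fun _ hx => (mem_gnbd_neg_of_nonneg hρ).1 hx (Metric.mem_closedBall_self hρ)

/-! ### Admissible pairs for a maximum of finitely many linear functions -/

/-- Maximality gives W(p) ≤ z·p, membership in the hull gives z·q ≤ W(q) for all q; combine the two.
-/
theorem mem_subdiff_of_mem_convexHull {k : ℕ} {F : Finset (RR k)} (hF : F.Nonempty)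
    {W : RR k → ℝ} (hW : ∀ p, W p = F.sup' hF fun a => inner ℝ a p) {z p : RR k}
    (hz : z ∈ convexHull ℝ (F : Set (RR k))) (hp : ∀ a ∈ F, (inner ℝ a p : ℝ) ≤ inner ℝ z p) :
    z ∈ subdiff W p := by
  intro q
  have h1 : W p ≤ inner ℝ z p := by
    rw [hW]; exact Finset.sup'_le _ _ hp
  have h2 : (inner ℝ z q : ℝ) ≤ W q := by
    have hconv : Convex ℝ {y : RR k | (inner ℝ y q : ℝ) ≤ W q} :=
      convex_halfSpace_le ⟨fun x y => inner_add_left x y q, fun c x => real_inner_smul_left x q c⟩ _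
    refine convexHull_min (fun a ha => ?_) hconv hz
    rw [mem_ofPred_eq, hW]
    exact Finset.le_sup' (fun a => (inner ℝ a q : ℝ)) ha
  rw [inner_sub_right]
  linarith

theorem LatticeCalibration.exists_admissible {k : ℕ} (hk : LatticeCalibration k) {A : SetPair k}
    (hA : A.IsBoundedPair) {ρ₁ ρ₂ : ℝ} (hρ₁ : 0 ≤ ρ₁) (hρ₁₂ : ρ₁ < ρ₂) {F : Finset (RR k)}
    (hF : F.Nonempty) {W : RR k → ℝ} (hW : ∀ p, W p = F.sup' hF fun a => inner ℝ a p) :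
    ∃ G : SetPair k, A.nbd ρ₁ ≤ G ∧ G ≤ A.nbd ρ₂ ∧
      ∃ ψ : RR k → ℝ, G.IsAdmissibleSupportFun W ψ ∧
        ∃ z ∈ cahnHoffman W ψ Set.univ, ∃ K, LipschitzWith K z := by
  have hρ₂ : 0 ≤ ρ₂ := hρ₁.trans hρ₁₂.le
  obtain ⟨a₀, ha₀⟩ := hF
  set P : Set (RR k) := convexHull ℝ (F : Set (RR k)) - {a₀} with hPdef
  have hPc : IsCompact P := by
    rw [hPdef, sub_singleton]
    exact (F.finite_toSet.isCompact_convexHull ℝ).image (by fun_prop)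
  have hPconv : Convex ℝ P := (convex_convexHull ℝ _).sub (convex_singleton a₀)
  have hmemP : ∀ y, y ∈ P ↔ y + a₀ ∈ convexHull ℝ (F : Set (RR k)) := fun y => by
    rw [hPdef, sub_singleton]
    constructor
    · rintro ⟨c, hc, rfl⟩; simpa using hc
    · intro h; exact ⟨_, h, by simp⟩
  have hFP : ∀ a ∈ F, a - a₀ ∈ P := fun a ha =>
    (hmemP _).2 (by simpa using subset_convexHull ℝ _ (Finset.mem_coe.2 ha))
  have hP0 : 0 ∈ P := by simpa using hFP a₀ ha₀
  -- One third for the spread of each calibration, and one for the gap between them.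
  set ε : ℝ := (ρ₂ - ρ₁) / 3 with hεdef
  have hε : 0 < ε := by rw [hεdef]; linarith
  have hρε : ρ₂ = ρ₁ + 3 * ε := by rw [hεdef]; ring
  have hbdd : (Bornology.IsBounded (gnbd ρ₁ A.plus) ∧
        Bornology.IsBounded (gnbd (-ρ₂) A.minus)ᶜ) ∨
      (Bornology.IsBounded (gnbd ρ₁ A.plus)ᶜ ∧ Bornology.IsBounded (gnbd (-ρ₂) A.minus)) := by
    rcases hA with h | h
    · exact Or.inl ⟨isBounded_gnbd hρ₁ (h.subset A.disj.subset_compl_left),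
        isBounded_compl_gnbd_neg hρ₂ h⟩
    · exact Or.inr ⟨h.subset (compl_subset_compl.2 (subset_gnbd hρ₁ _)),
        h.subset ((gnbd_neg_subset hρ₂ _).trans A.disj.subset_compl_right)⟩
  obtain ⟨ψ₁, z₁, ⟨K₁, hK₁⟩, ⟨L₁, hL₁⟩, hψ₁, hz₁, hcal₁, hpos₁, hnear₁, hsupp₁⟩ :=
    hk.exists_calibration hPc hPconv hP0 (gnbd ρ₁ A.plus) (hbdd.imp And.left And.left) hε
  obtain ⟨ψ₂, z₂, ⟨K₂, hK₂⟩, ⟨L₂, hL₂⟩, hψ₂, hz₂, hcal₂, hpos₂, hnear₂, hsupp₂⟩ :=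
    hk.exists_calibration hPc.neg hPconv.neg (by simpa using hP0) (gnbd (-ρ₂) A.minus)
      (hbdd.symm.imp And.right And.right) hε
  have hV₁ : ∀ x, (ψ₁ x ≠ 0 ∨ z₁ x ≠ 0) → ∃ e ∈ A.plus, dist x e ≤ ρ₁ + ε := by
    intro x hx
    obtain ⟨y, hy, hxy⟩ := hnear₁ x hx
    obtain ⟨e, he, hye⟩ := (mem_gnbd_of_nonneg hρ₁).1 hy
    exact ⟨e, he, by linarith [dist_triangle x y e]⟩
  have hV₂ : ∀ x, (ψ₂ x ≠ 0 ∨ z₂ x ≠ 0) → Metric.closedBall x (ρ₁ + 2 * ε) ⊆ A.minus := by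
    intro x hx
    obtain ⟨y, hy, hxy⟩ := hnear₂ x hx
    refine subset_trans (fun u hu => ?_) ((mem_gnbd_neg_of_nonneg hρ₂).1 hy)
    rw [Metric.mem_closedBall] at hu ⊢
    linarith [dist_triangle u x y]
  have hsep : ∀ x y, (ψ₁ x ≠ 0 ∨ z₁ x ≠ 0) → (ψ₂ y ≠ 0 ∨ z₂ y ≠ 0) → ε < dist x y := by
    intro x y hx hy
    by_contra! hxy
    obtain ⟨e, he, hd⟩ := hV₁ x hx
    refine Set.disjoint_left.1 A.disj (hV₂ y hy ?_) he
    rw [Metric.mem_closedBall, dist_comm]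
    linarith [dist_triangle_left y e x]
  have hdisj : ∀ x, ψ₁ x ≠ 0 → ψ₂ x = 0 := fun x h1 => by
    by_contra h2
    have := hsep x x (Or.inl h1) (Or.inl h2)
    rw [dist_self] at this
    linarith
  let G : SetPair k :=
    { minus := {x | 0 < ψ₂ x}
      plus := {x | 0 < ψ₁ x}
      disj := Set.disjoint_left.2 fun x (h2 : 0 < ψ₂ x) (h1 : 0 < ψ₁ x) =>
        h2.ne' (hdisj x h1.ne') }
  set ψ : RR k → ℝ := fun x => ψ₁ x - ψ₂ x with hψdef
  set ζ : RR k → RR k := fun x => z₁ x - z₂ x with hζdef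
  have hζL : LipschitzWith (L₁ + L₂) ζ := hL₁.sub hL₂
  have hζs : HasCompactSupport ζ := hsupp₁.sub hsupp₂
  have hzL : LipschitzWith (L₁ + L₂) fun x => ζ x + a₀ :=
    LipschitzWith.of_dist_le_mul fun x y => by simpa using hζL.dist_le_mul x y
  -- By the gap, at most one of the two pairs is nonzero on a ball of radius `ε / 2`.
  have hcal : ∀ᵐ x, ζ x ∈ P ∧ CalibratesAt P ψ (ζ x) x := by
    filter_upwards [hcal₁, hcal₂] with x h1 h2
    have hball : ∀ᶠ y in 𝓝 x, dist y x < ε / 2 := Metric.ball_mem_nhds x (half_pos hε)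
    by_cases hx : ∃ y, dist y x < ε / 2 ∧ (ψ₁ y ≠ 0 ∨ z₁ y ≠ 0)
    · obtain ⟨y, hyx, hy⟩ := hx
      have hzero : ∀ u, dist u x < ε / 2 → ψ₂ u = 0 ∧ z₂ u = 0 := fun u hu => by
        by_contra! hcon
        have := hsep y u hy (by tauto)
        linarith [dist_triangle_right y u x]
      have hζx : ζ x = z₁ x := by simp [hζdef, (hzero x (by simpa using hε)).2]
      rw [hζx]
      refine ⟨hz₁ x, h1.congr ?_⟩
      filter_upwards [hball] with u hu
      simp [hψdef, (hzero u hu).1]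
    · push Not at hx
      have hζx : ζ x = -z₂ x := by simp [hζdef, (hx x (by simpa using hε)).2]
      rw [hζx]
      refine ⟨hz₂ x, h2.neg.congr ?_⟩
      filter_upwards [hball] with u hu
      simp [hψdef, (hx u hu).1]
  have hCH : (fun x => ζ x + a₀) ∈ cahnHoffman W ψ Set.univ := by
    refine ⟨?_, exists_hasWeakDivOn hζL hζs a₀, ?_⟩
    · obtain ⟨C, hC⟩ := hζs.exists_bound_of_continuous hζL.continuous
      exact memLp_top_of_bound hzL.continuous.aestronglyMeasurable (C + ‖a₀‖)
        (Filter.Eventually.of_forall fun x => (norm_add_le _ _).trans (by linarith [hC x]))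
    · rw [Measure.restrict_univ]
      filter_upwards [hcal] with x hx
      refine mem_subdiff_of_mem_convexHull ⟨a₀, ha₀⟩ hW ((hmemP _).1 hx.1) fun a ha => ?_
      by_cases hd : DifferentiableAt ℝ ψ x
      · have := hx.2 _ hd.hasGradientAt _ (hFP a ha)
        rw [inner_sub_left] at this
        rw [inner_add_left]
        linarith
      -- Here `gradient` takes its default value 0, for which the maximality condition is trivial.
      · simp [gradient_eq_zero_of_not_differentiableAt hd]
  refine ⟨G, ⟨hpos₁, fun x hx => ?_⟩, ⟨fun x hx => ?_, hpos₂⟩, ψ, ⟨⟨?_, ?_⟩, ?_, ⟨⟨_, hK₁.sub hK₂⟩,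
    fun x hx => ?_, fun x hx => ?_, fun x hx => ?_⟩, univ, isOpen_univ, subset_univ _, _, hCH⟩,
    _, hCH, _, hzL⟩
  · refine (mem_gnbd_neg_of_nonneg hρ₁).2 (subset_trans ?_ (hV₂ x (Or.inl hx.ne')))
    exact Metric.closedBall_subset_closedBall (by linarith)
  · obtain ⟨e, he, hd⟩ := hV₁ x (Or.inl hx.ne')
    exact (mem_gnbd_of_nonneg hρ₂).2 ⟨e, he, by linarith⟩
  · exact isOpen_lt continuous_const hK₂.continuous
  · exact isOpen_lt continuous_const hK₁.continuous
  · rcases hbdd with h | h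
    · exact Or.inl (h.2.subset (compl_subset_compl.2 hpos₂))
    · exact Or.inr (h.1.subset (compl_subset_compl.2 hpos₁))
  · have h1 : 0 < ψ₁ x := hx
    simpa [hψdef, hdisj x h1.ne'] using h1
  · have h2 : ¬ 0 < ψ₂ x := hx.1
    have h1 : ¬ 0 < ψ₁ x := hx.2
    have := hψ₁ x
    have := hψ₂ x
    simp only [hψdef]
    linarith
  · have h2 : 0 < ψ₂ x := hx
    have h1 : ψ₁ x = 0 := by
      by_contra h1
      exact h2.ne' (hdisj x h1)
    simpa [hψdef, h1] using h2

/-! ### Polyhedral functions -/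

/-- Near a point, along each ray, a polyhedral function is the maximum of finitely many affine
functions with equal values at that point. -/
theorem PolyhedralFun.exists_eventually_eq {n : ℕ} {W : RR n → ℝ} (hW : PolyhedralFun W)
    (p : RR n) : ∃ (F : Finset (RR n)) (hF : F.Nonempty), ∀ q, ∀ᶠ t in 𝓝[>] (0 : ℝ),
      W (p + t • q) = W p + t * F.sup' hF fun a => inner ℝ a q := by
  classical
  obtain ⟨s, hs, hW⟩ := hW
  -- Only the pieces active at `p` matter: the finitely many others are strictly below at `p`, and
  -- stay below for small t depending on the ray.
  set act := s.filter fun a => inner ℝ a.1 p + a.2 = W p with hact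
  have hne : act.Nonempty := by
    obtain ⟨a, ha, he⟩ := Finset.exists_mem_eq_sup' hs fun a : RR n × ℝ => inner ℝ a.1 p + a.2
    exact ⟨a, Finset.mem_filter.2 ⟨ha, by rw [hW, he]⟩⟩
  refine ⟨act.image Prod.fst, hne.image _, fun q => ?_⟩
  set M := (act.image Prod.fst).sup' (hne.image _) fun a => (inner ℝ a q : ℝ) with hM
  have hle : ∀ a ∈ s, ∀ᶠ t in 𝓝[>] (0 : ℝ), inner ℝ a.1 (p + t • q) + a.2 ≤ W p + t * M := by
    intro a ha
    by_cases hap : inner ℝ a.1 p + a.2 = W p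
    · have h1 : inner ℝ a.1 q ≤ M := Finset.le_sup' (fun a => (inner ℝ a q : ℝ))
        (Finset.mem_image_of_mem _ (Finset.mem_filter.2 ⟨ha, hap⟩))
      filter_upwards [self_mem_nhdsWithin] with t ht
      rw [inner_add_right, real_inner_smul_right]
      nlinarith [mul_le_mul_of_nonneg_left h1 (le_of_lt (mem_Ioi.1 ht))]
    · have h1 : inner ℝ a.1 p + a.2 < W p := by
        refine lt_of_le_of_ne ?_ hap
        rw [hW p]
        exact Finset.le_sup' (fun a : RR n × ℝ => (inner ℝ a.1 p : ℝ) + a.2) ha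
      have hc1 : ContinuousAt (fun t : ℝ => (inner ℝ a.1 (p + t • q) : ℝ) + a.2) 0 := by fun_prop
      have hc2 : ContinuousAt (fun t : ℝ => W p + t * M) 0 := by fun_prop
      have h2 := hc1.eventually_lt hc2 (by simpa using h1)
      exact (h2.filter_mono nhdsWithin_le_nhds).mono fun t ht => ht.le
  have hall : ∀ᶠ t in 𝓝[>] (0 : ℝ), ∀ a ∈ s, inner ℝ a.1 (p + t • q) + a.2 ≤ W p + t * M :=
    (Filter.eventually_all_finset s).2 hle
  filter_upwards [hall] with t ht
  refine le_antisymm ?_ ?_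
  · rw [hW]
    exact Finset.sup'_le _ _ ht
  · obtain ⟨a, ha, he⟩ := Finset.exists_mem_eq_sup' (hne.image Prod.fst)
      fun a : RR n => (inner ℝ a q : ℝ)
    obtain ⟨c, hc, rfl⟩ := Finset.mem_image.1 ha
    obtain ⟨hcs, hcp⟩ := Finset.mem_filter.1 hc
    rw [hM, he, hW (p + t • q), ← hcp]
    refine le_trans (le_of_eq ?_) (Finset.le_sup' _ hcs)
    rw [inner_add_right, real_inner_smul_right]
    ring

theorem PolyhedralFun.exists_eq_sup'_of_posHomogeneous {n : ℕ} {W : RR n → ℝ}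
    (hW : PolyhedralFun W) (hhom : PosHomogeneous W) :
    ∃ (F : Finset (RR n)) (hF : F.Nonempty), ∀ q, W q = F.sup' hF fun a => inner ℝ a q := by
  obtain ⟨F, hF, h⟩ := hW.exists_eventually_eq 0
  refine ⟨F, hF, fun q => ?_⟩
  obtain ⟨t, ht, ht0⟩ := ((h q).and self_mem_nhdsWithin).exists
  have ht0 : 0 < t := ht0
  have hW0 : W 0 = 0 := by simpa using hhom 0 le_rfl 0
  rw [zero_add, hhom t ht0.le, hW0, zero_add] at ht
  exact mul_left_cancel₀ ht0.ne' ht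

theorem PolyhedralFun.exists_dirDeriv_eq_sup' {n : ℕ} {W : RR n → ℝ} (hW : PolyhedralFun W)
    (p : RR n) : ∃ (F : Finset (RR n)) (hF : F.Nonempty), ∀ q,
      dirDeriv W p q = F.sup' hF fun a => inner ℝ a q := by
  obtain ⟨F, hF, h⟩ := hW.exists_eventually_eq p
  refine ⟨F, hF, fun q => ?_⟩
  set M := F.sup' hF fun a => (inner ℝ a q : ℝ)
  have h1 : HasDerivWithinAt (fun t : ℝ => W p + t * M) M (Ioi 0) 0 := by
    simpa using (((hasDerivAt_id (0 : ℝ)).mul_const M).const_add (W p)).hasDerivWithinAt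
  exact (h1.congr_of_eventuallyEq (h q) (by simp)).derivWithin (uniqueDiffWithinAt_Ioi 0)

theorem PolyhedralFun.exists_slicedDensity_eq_sup' {n k : ℕ} {W : RR n → ℝ}
    (hW : PolyhedralFun W) (p : RR n) (T : RR k ≃ₗᵢ[ℝ] featureSpace W p) :
    ∃ (F : Finset (RR k)) (hF : F.Nonempty), ∀ q,
      slicedDensity W p T q = F.sup' hF fun a => inner ℝ a q := by
  classical
  obtain ⟨F, hF, h⟩ := hW.exists_dirDeriv_eq_sup' p
  let L : RR k →L[ℝ] RR n :=
    (featureSpace W p).subtypeL.comp (T.toContinuousLinearEquiv : RR k →L[ℝ] featureSpace W p)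
  -- The adjoint pulls the slopes back to ℝᵏ, because ⟨a, Lq⟩ = ⟨L*a, q⟩.
  refine ⟨F.image (ContinuousLinearMap.adjoint L), hF.image _, fun q => ?_⟩
  rw [slicedDensity, h, Finset.sup'_image]
  refine Finset.sup'_congr hF rfl fun a _ => ?_
  rw [Function.comp_apply, ContinuousLinearMap.adjoint_inner_left]
  rfl

theorem proposition6p1 (k : ℕ) (hk : k = 1 ∨ k = 2) (A : SetPair k) (hA : A.IsBoundedPair)
    (ρ₁ ρ₂ : ℝ) (hρ₁ : 0 ≤ ρ₁) (hρ₁₂ : ρ₁ < ρ₂) :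
    (∀ W : RR k → ℝ, ConvexOn ℝ Set.univ W → PosHomogeneous W → PolyhedralFun W →
      (∃ δ : ℝ, 0 < δ ∧ ∀ p, δ * ‖p‖ ≤ W p) →
      ∃ G : SetPair k, A.nbd ρ₁ ≤ G ∧ G ≤ A.nbd ρ₂ ∧
        ∃ ψ : RR k → ℝ, G.IsAdmissibleSupportFun W ψ ∧
          ∃ z ∈ cahnHoffman W ψ Set.univ, ∃ K, LipschitzWith K z) ∧
    (∀ (n : ℕ) (W : RR n → ℝ), ConvexOn ℝ Set.univ W → PolyhedralFun W →
      ∀ p₀ : RR n, Module.finrank ℝ (featureSpace W p₀) = k →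
      ∀ T : RR k ≃ₗᵢ[ℝ] featureSpace W p₀,
      ∃ G : SetPair k, A.nbd ρ₁ ≤ G ∧ G ≤ A.nbd ρ₂ ∧
        ∃ ψ : RR k → ℝ, G.IsSlicedAdmissibleSupportFun W p₀ T ψ ∧
          ∃ z ∈ cahnHoffman (slicedDensity W p₀ T) ψ Set.univ, ∃ K, LipschitzWith K z) := by
  have hLC : LatticeCalibration k := by
    rcases hk with rfl | rfl
    · exact latticeCalibration_one
    · exact latticeCalibration_two
  refine ⟨fun W _ hhom hpoly _ => ?_, fun n W _ hpoly p₀ _ T => ?_⟩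
  · obtain ⟨F, hF, hW⟩ := hpoly.exists_eq_sup'_of_posHomogeneous hhom
    exact hLC.exists_admissible hA hρ₁ hρ₁₂ hF hW
  · obtain ⟨F, hF, hW⟩ := hpoly.exists_slicedDensity_eq_sup' p₀ T
    exact hLC.exists_admissible hA hρ₁ hρ₁₂ hF hW
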